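/- Let $T\subset\mathbb{R}^2$ be the triangle with vertices $(0,0)$, $(1,0)$, $(0,1)$. For $n\ge 0$ let $\mathbf X_1,\dots,\mathbf X_n$ be independent and uniformly distributed random points in $T$, let $T_n$ be the convex hull of $(1,0),(0,1),\mathbf X_1,\dots,\mathbf X_n$, let $f_0(T_n)$ be its number of vertices, and put $p_k^{(n)}:=\mathbb{P}(f_0(T_n)=k+2)$. Let $G_0(z):=1$, $G_1(z):=z$, $G_n(z):=\sum_{k=1}^n p_k^{(n)}z^k$ for $n\ge 2$, and $$F(u,z):=\sum_{n=0}^\infty G_n(z)\,u^n\in\mathbb{C}[[u,z]],\qquad \Xi:=u\frac{\partial}{\partial u}.$$ (i) In $\mathbb{C}[[u,z]]$ one has $$(1-u)^2(\Xi+1)\,\Xi F=2uz\,F.$$ (ii) For every $H\in\mathbb{C}[[u,z]]$ the equation $(1-u)^2(\Xi+1)\Xi H=2uzH$ is equivalent to the identity $H_{uu}+\frac{2}{u}H_u-\frac{2z}{u(u-1)^2}H=0$, read in the field of fractions of $\mathbb{C}[[u,z]]$. Hence $$F_{uu}+\frac{2}{u}F_u-\frac{2z}{u(u-1)^2}F=0,\qquad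 F(0,z)=1,\quad F_u(0,z)=z,$$ as identities of formal power series. Moreover, for every $z\in\mathbb{C}$ with $|z|\le 1$ the series $\sum_n G_n(z)u^n$ converges for all $|u|<1$, defines a holomorphic function of $u$ there, and this function satisfies the same equation for $0<|u|<1$ and the same initial conditions at $u=0$. (iii) Consider, for a parameter $z\in\mathbb{C}$, the differential equation $y''+Py'+Qy=0$ with the meromorphic coefficients $P(u)=\frac2u$ and $Q(u)=-\frac{2z}{u(u-1)^2}$. The point $u=0$ is a regular singularity of it for every $z$, and $u=1$ and $u=\infty$ are regular singularities of it for every $z\neq 0$. Here $a\in\mathbb{C}$ is a regular singularity if $P$ or $Q$ has a pole at $a$ and these poles have order at most $1$ and $2$, respectively; $\infty$ is a regular singularity if the equation obtained by substituting $u=1/v$ has a regular singularity at $v=0$. -/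

import Mathlib

open MeasureTheory ProbabilityTheory

noncomputable section

namespace ConvexChain

/-! ### The random convex chain -/

/-- The triangle `T` with vertices `(0,0)`, `(1,0)`, `(0,1)`. -/
def triangle : Set (ℝ × ℝ) :=
  convexHull ℝ {((0 : ℝ), (0 : ℝ)), (1, 0), (0, 1)}

/-- The joint law of `n` independent random points, each uniformly distributed in the triangle
(`volume` on `ℝ × ℝ` is two-dimensional Lebesgue measure). -/
def pointsLaw (n : ℕ) : Measure (Fin n → ℝ × ℝ) :=
  Measure.pi fun _ => ProbabilityTheory.cond volume triangle

/-- `T_n = conv {(1,0), (0,1), x_1, …, x_n}`. -/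
def hull {n : ℕ} (x : Fin n → ℝ × ℝ) : Set (ℝ × ℝ) :=
  convexHull ℝ ({((1 : ℝ), (0 : ℝ)), (0, 1)} ∪ Set.range x)

/-- `f₀(T_n)`, the number of vertices of the convex polygon `T_n`. -/
def numVertices {n : ℕ} (x : Fin n → ℝ × ℝ) : ℕ :=
  (Set.extremePoints ℝ (hull x)).ncard

/-- `p_k^{(n)} = ℙ(f₀(T_n) = k + 2)`. -/
def vertexProb (n k : ℕ) : ℝ :=
  (pointsLaw n).real {x | numVertices x = k + 2}

/-- The generating polynomials: `G_0 = 1`, `G_1 = z` and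
`G_n = ∑_{k=1}^n p_k^{(n)} z^k` for `n ≥ 2`. -/
def genPoly : ℕ → Polynomial ℂ
  | 0 => 1
  | 1 => Polynomial.X
  | n + 2 => ∑ k ∈ Finset.Icc 1 (n + 2),
      Polynomial.C ((vertexProb (n + 2) k : ℝ) : ℂ) * Polynomial.X ^ k

/-! ### Formal power series in `u` and `z` -/

/-- The ring `ℂ[[u,z]]`; index `0` stands for `u`, index `1` for `z`. -/
abbrev Series : Type := MvPowerSeries (Fin 2) ℂ

/-- The variable `u`. -/
def uVar : Series := MvPowerSeries.X 0

/-- The variable `z`. -/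
def zVar : Series := MvPowerSeries.X 1

/-- `F(u,z) = ∑_n G_n(z) u^n`: the coefficient of `u^i z^j` is that of `z^j` in `G_i`. -/
def genF : Series := fun m => (genPoly (m 0)).coeff (m 1)

/-- The partial derivative `∂/∂u`. -/
def dU (H : Series) : Series := MvPowerSeries.pderiv ℂ 0 H

/-- The operator `Ξ = u ∂/∂u`. -/
def Xi (H : Series) : Series := uVar * dU H

/-- `H(0,z)` as an element of `ℂ[[z]]`. -/
def atUZero (H : Series) : PowerSeries ℂ :=
  PowerSeries.mk fun j => MvPowerSeries.coeff (Finsupp.single 1 j) H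

/-- The equation `(1-u)² (Ξ+1) Ξ H = 2uz H` in `ℂ[[u,z]]`. -/
def ThetaEquation (H : Series) : Prop :=
  (1 - uVar) ^ 2 * (Xi (Xi H) + Xi H) = 2 * uVar * zVar * H

/-- The embedding of `ℂ[[u,z]]` into its field of fractions. -/
def toFrac (H : Series) : FractionRing Series := algebraMap Series (FractionRing Series) H

/-- The equation `H_uu + (2/u) H_u - 2z/(u(u-1)²) H = 0` as an identity of formal series; because
of the denominators it is written in the field of fractions of `ℂ[[u,z]]`. -/
def FormalODE (H : Series) : Prop :=
  toFrac (dU (dU H)) + 2 / toFrac uVar * toFrac (dU H)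
    - 2 * toFrac zVar / (toFrac uVar * (toFrac uVar - 1) ^ 2) * toFrac H = 0

/-! ### The equation over the complex numbers -/

/-- The value `∑_n G_n(z) u^n` at complex arguments. -/
def evalF (z u : ℂ) : ℂ := ∑' n : ℕ, (genPoly n).eval z * u ^ n

/-- The coefficient `P(u) = 2/u`. -/
def coeffP (u : ℂ) : ℂ := 2 / u

/-- The coefficient `Q(u) = -2z/(u(u-1)²)`, for a given parameter `z`. -/
def coeffQ (z u : ℂ) : ℂ := -(2 * z / (u * (u - 1) ^ 2))

/-- The point `a ∈ ℂ` is a regular singularity of `y'' + P y' + Q y = 0`: the coefficients are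
meromorphic at `a`, at least one of them has a pole there, and the poles of `P` and `Q` have order
at most one and two. -/
def IsRegularSingularity (P Q : ℂ → ℂ) (a : ℂ) : Prop :=
  MeromorphicAt P a ∧ MeromorphicAt Q a ∧
  (meromorphicOrderAt P a < 0 ∨ meromorphicOrderAt Q a < 0) ∧
  -1 ≤ meromorphicOrderAt P a ∧ -2 ≤ meromorphicOrderAt Q a

/-- The point `∞` is a regular singularity of `y'' + P y' + Q y = 0`: in the coordinate `v = 1/u`
the equation for `w(v) = y(1/v)` reads `w'' + (2/v - P(1/v)/v²) w' + (Q(1/v)/v⁴) w = 0`, and it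
has a regular singularity at `v = 0`. -/
def IsRegularSingularityAtInfinity (P Q : ℂ → ℂ) : Prop :=
  IsRegularSingularity (fun v => 2 / v - P (1 / v) / v ^ 2) (fun v => Q (1 / v) / v ^ 4) 0

end ConvexChain

end

/-!
The coefficients of `F` are governed by a recursion that comes from peeling one vertex off the
random chain. Look at the points from `(1,0)`. Almost surely there is a strictly lowest one,
`X = (a, s(1-a))`, where `s` is the slope of its line of sight; it is the vertex next to `(1,0)`.
All other points lie in the triangle with vertices `(1,0)`, `(0,s)`, `(0,1)`, which has relative
area `1-s`. The segment from `X` to `(0,1)` cuts it into two triangles. Points in the one at `(1,0)`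
(relative area `(1-s)(1-a)`) never become vertices. Those in the other one (relative area `(1-s)a`)
are uniform there, and this triangle is the image of the original one under an affine map carrying
`(1,0)` to `X` and fixing `(0,1)`; hence they form, together with `X` and `(0,1)`, a random
chain of the same kind with fewer points. Removing `(1,0)` costs exactly one vertex
(`vertexCount_insert_wedge`). Integrating over `X`, the number of points that remain after the first
of `n + 1` is `i` with probability `2(j+1)/((n+1)(n+2))`, where `i + j = n` (`vertexMean_succ`), so

`(n+1)(n+2) G_{n+1}(z) = 2z ∑_{i+j=n} (j+1) G_i(z)`.

As `∑_j (j+1) u^j = (1-u)⁻²`, this is the equation `(1-u)² (Ξ+1) Ξ F = 2uz F`, coefficient by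
coefficient. Its traditional form follows from `(Ξ+1) Ξ H = u² H_uu + 2u H_u` and cancellation in
the field of fractions. The recursion also bounds `|G_n(z)|` by `1` for `|z| ≤ 1`, because its
weights add up to `1`; this gives the convergence in the unit disc, where the power series may be
differentiated term by term. The statements on singularities are read off from the factorizations
of the coefficients.

The measure theory has three ingredients: the number of vertices is a measurable function of the
points even where points coincide (`measurable_vertexCount_range`); the distribution of the further
points given `X` is expanded by a binomial theorem for powers of a sum of two measures, one of
which is invisible to the functional (`lintegral_pi_add`); and ties for the lowest point are
negligible since the total mass of the recursion is `1`.
-/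

noncomputable section

namespace ConvexChain

/-! ### Extreme points of convex hulls -/

section Extreme

variable {E : Type*} [AddCommGroup E] [Module ℝ E]

lemma mem_convexHull_insert_iff {S : Set E} (hS : S.Nonempty) {A p : E} :
    p ∈ convexHull ℝ (insert A S) ↔
      ∃ c ∈ convexHull ℝ S, ∃ l : ℝ, 0 ≤ l ∧ l ≤ 1 ∧ p = (1 - l) • A + l • c := by
  rw [convexHull_insert hS, mem_convexJoin]
  constructor
  · rintro ⟨x, rfl, c, hc, s, t, hs, ht, hst, rfl⟩
    exact ⟨c, hc, t, ht, by linarith, by rw [← hst]; simp⟩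
  · rintro ⟨c, hc, l, h0, h1, rfl⟩
    exact ⟨A, rfl, c, hc, 1 - l, l, by linarith, h0, by ring, rfl⟩

/-- A point is extreme in a convex hull iff it is a generator that the others do not span. -/
lemma mem_extremePoints_convexHull_iff {S : Set E} {p : E} :
    p ∈ (convexHull ℝ S).extremePoints ℝ ↔ p ∈ S ∧ p ∉ convexHull ℝ (S \ {p}) := by
  constructor
  · intro h
    refine ⟨extremePoints_convexHull_subset h, fun hp => ?_⟩
    rw [(convex_convexHull ℝ S).mem_extremePoints_iff_mem_sdiff_convexHull_sdiff] at h
    exact h.2 (convexHull_mono (Set.sdiff_subset_sdiff_left (subset_convexHull ℝ S)) hp)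
  · rintro ⟨hpS, hp⟩
    have hS : insert p (S \ {p}) = S := by simp [hpS]
    rcases (S \ {p}).eq_empty_or_nonempty with he | hne
    · rw [← hS, he]; simp
    rw [mem_extremePoints_iff_left]
    refine ⟨subset_convexHull ℝ S hpS, fun x hx y hy hxy => ?_⟩
    rw [← hS, mem_convexHull_insert_iff hne] at hx hy
    obtain ⟨c, hc, l, l0, l1, rfl⟩ := hx
    obtain ⟨d, hd, m, m0, m1, rfl⟩ := hy
    obtain ⟨s, t, hs, ht, hst, h⟩ := hxy
    rcases l0.eq_or_lt with rfl | lpos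
    · simp
    exfalso
    apply hp
    have hpos : 0 < s * l + t * m := by positivity
    have h2 : (s * l + t * m) • p = (s * l) • c + (t * m) • d := by
      have h3 : s • ((1 - l) • p + l • c) + t • ((1 - m) • p + m • d)
          = (s + t) • p - (s * l + t * m) • p + ((s * l) • c + (t * m) • d) := by module
      rw [h3, hst, one_smul] at h
      have h4 := congrArg (fun z => z - p + (s * l + t * m) • p) h
      calc (s * l + t * m) • p = p - p + (s * l + t * m) • p := by simp
        _ = _ := by rw [← h4]; abel
    have h5 : p = (s * l / (s * l + t * m)) • c + (t * m / (s * l + t * m)) • d := by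
      rw [div_eq_inv_mul, div_eq_inv_mul, mul_smul _ _ c, mul_smul _ _ d, ← smul_add, ← h2,
        smul_smul, inv_mul_cancel₀ hpos.ne', one_smul]
    have h6 := convex_convexHull ℝ _ hc hd (a := s * l / (s * l + t * m))
      (b := t * m / (s * l + t * m)) (by positivity) (by positivity)
      (by rw [← add_div, div_self hpos.ne'])
    rwa [← h5] at h6

/-- The number of vertices of the convex hull of `S`. -/
def vertexCount (S : Set E) : ℕ := ((convexHull ℝ S).extremePoints ℝ).ncard

lemma vertexCount_image {F : Type*} [AddCommGroup F] [Module ℝ F] (f : E →ᵃ[ℝ] F)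
    (hf : Function.Injective f) (S : Set E) : vertexCount (f '' S) = vertexCount S := by
  have : (convexHull ℝ (f '' S)).extremePoints ℝ = f '' ((convexHull ℝ S).extremePoints ℝ) := by
    ext q
    constructor
    · intro hq
      obtain ⟨p, hp, rfl⟩ := extremePoints_convexHull_subset hq
      refine ⟨p, ?_, rfl⟩
      rw [mem_extremePoints_convexHull_iff] at hq ⊢
      refine ⟨hp, fun h => hq.2 ?_⟩
      rw [← Set.image_singleton, ← Set.image_sdiff hf, ← AffineMap.image_convexHull]
      exact ⟨p, h, rfl⟩
    · rintro ⟨p, hp, rfl⟩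
      rw [mem_extremePoints_convexHull_iff] at hp ⊢
      refine ⟨⟨p, hp.1, rfl⟩, fun h => hp.2 ?_⟩
      rw [← Set.image_singleton, ← Set.image_sdiff hf, ← AffineMap.image_convexHull] at h
      obtain ⟨r, hr, hrp⟩ := h
      exact hf hrp ▸ hr
  rw [vertexCount, this, Set.ncard_image_of_injective _ hf, vertexCount]

/-- Removing the end point `A` of a convex chain whose next vertex is `X` and whose other end point
is `B`: the remaining extreme points are those of the shorter chain. The last hypothesis says that
every point `p` of `W` is cut off from `A` by the segment `[X, B]`: the segment `[A, p]` meets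
it. -/
lemma extremePoints_convexHull_insert {A X B : E} {W : Set E}
    (hA : A ∉ convexHull ℝ (insert X (insert B W)))
    (hX : X ∈ (convexHull ℝ (insert A (insert X (insert B W)))).extremePoints ℝ)
    (hB : B ∈ (convexHull ℝ (insert A (insert X (insert B W)))).extremePoints ℝ)
    (hW : ∀ p ∈ W, ∃ δ : ℝ, 0 ≤ δ ∧ ∃ r ∈ segment ℝ X B, (1 + δ) • r = p + δ • A) :
    (convexHull ℝ (insert A (insert X (insert B W)))).extremePoints ℝ =
      insert A ((convexHull ℝ (insert X (insert B W))).extremePoints ℝ) := by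
  set V := insert X (insert B W) with hV
  have hsub : convexHull ℝ V ⊆ convexHull ℝ (insert A V) := convexHull_mono (Set.subset_insert _ _)
  have hAV : A ∉ V := fun h => hA (subset_convexHull ℝ V h)
  apply Set.Subset.antisymm
  · intro p hp
    rcases extremePoints_convexHull_subset hp with rfl | hpV
    · exact Set.mem_insert _ _
    · exact Set.mem_insert_of_mem _ (inter_extremePoints_subset_extremePoints_of_subset hsub
        ⟨subset_convexHull ℝ V hpV, hp⟩)
  · rintro p (rfl | hp)
    · rw [mem_extremePoints_convexHull_iff]
      refine ⟨Set.mem_insert _ _, ?_⟩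
      rwa [Set.insert_sdiff_of_mem _ (Set.mem_singleton _), Set.sdiff_singleton_eq_self hAV]
    have hpV : p ∈ V := extremePoints_convexHull_subset hp
    by_cases hpX : p = X
    · rwa [hpX]
    by_cases hpB : p = B
    · rwa [hpB]
    have hpW : p ∈ W := by
      rcases hpV with h | h | h
      · exact absurd h hpX
      · exact absurd h hpB
      · exact h
    rw [mem_extremePoints_convexHull_iff] at hp ⊢
    refine ⟨Set.mem_insert_of_mem _ hpV, fun h => hp.2 ?_⟩
    have hpA : A ∉ ({p} : Set E) := fun h => hAV (by rw [Set.mem_singleton_iff.1 h]; exact hpV)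
    have hXV : X ∈ V \ {p} := ⟨Set.mem_insert _ _, fun h => hpX (Set.mem_singleton_iff.1 h).symm⟩
    have hBV : B ∈ V \ {p} := ⟨Set.mem_insert_of_mem _ (Set.mem_insert _ _),
      fun h => hpB (Set.mem_singleton_iff.1 h).symm⟩
    rw [Set.insert_sdiff_of_notMem _ hpA, mem_convexHull_insert_iff ⟨X, hXV⟩] at h
    obtain ⟨c, hc, l, l0, l1, hpc⟩ := h
    obtain ⟨δ, hδ, r, hr, hrp⟩ := hW p hpW
    have hr' : r ∈ convexHull ℝ (V \ {p}) :=
      (convex_convexHull ℝ _).segment_subset (subset_convexHull ℝ _ hXV)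
        (subset_convexHull ℝ _ hBV) hr
    -- Eliminating `A` from `p = (1 - l) A + l c` and `(1 + δ) r = p + δ A` puts `p` on `[r, c]`.
    have key : (δ + (1 - l)) • p = ((1 - l) * (1 + δ)) • r + (δ * l) • c := by
      have e1 : (δ * l) • c = δ • p - (δ * (1 - l)) • A := by
        rw [hpc]; module
      have e2 : ((1 - l) * (1 + δ)) • r = (1 - l) • p + ((1 - l) * δ) • A := by
        rw [mul_smul, hrp]; module
      rw [e1, e2]; module
    rcases (by linarith : 0 ≤ δ + (1 - l)).eq_or_lt with h0 | hpos
    · have hl : l = 1 := by linarith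
      have : p = c := by rw [hpc, hl]; simp
      rwa [this] at hc ⊢
    · have h5 : p = ((1 - l) * (1 + δ) / (δ + (1 - l))) • r + (δ * l / (δ + (1 - l))) • c := by
        rw [div_eq_inv_mul, div_eq_inv_mul, mul_smul _ _ r, mul_smul _ _ c, ← smul_add, ← key,
          smul_smul, inv_mul_cancel₀ hpos.ne', one_smul]
      rw [h5]
      have h1l : 0 ≤ 1 - l := by linarith
      refine convex_convexHull ℝ _ ?_ ?_ (by positivity) (by positivity) (by field_simp; ring)
      · rw [← h5]; exact hr'
      · rw [← h5]; exact hc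

lemma extremePoint_of_forall_lt {S : Set E} {p : E} (hp : p ∈ S) (f : E →ₗ[ℝ] ℝ)
    (h : ∀ q ∈ S, q ≠ p → f q < f p) : p ∈ (convexHull ℝ S).extremePoints ℝ := by
  rw [mem_extremePoints_convexHull_iff]
  refine ⟨hp, fun hh => ?_⟩
  have : convexHull ℝ (S \ {p}) ⊆ {q | f q < f p} :=
    convexHull_min (fun q hq => h q hq.1 hq.2) (convex_halfSpace_lt f.isLinear _)
  exact lt_irrefl (f p) (this hh)

end Extreme

/-! ### The triangle and its affine images -/

lemma mem_triangle_iff {p : ℝ × ℝ} : p ∈ triangle ↔ 0 ≤ p.1 ∧ 0 ≤ p.2 ∧ p.1 + p.2 ≤ 1 := by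
  constructor
  · intro h
    have hc : Convex ℝ {p : ℝ × ℝ | 0 ≤ p.1 ∧ 0 ≤ p.2 ∧ p.1 + p.2 ≤ 1} := by
      rintro ⟨x1, x2⟩ ⟨h1, h2, h3⟩ ⟨y1, y2⟩ ⟨k1, k2, k3⟩ s t hs ht hst
      simp only [Prod.smul_mk, smul_eq_mul, Prod.mk_add_mk, Set.mem_ofPred_eq] at *
      refine ⟨by positivity, by positivity, ?_⟩
      nlinarith
    refine convexHull_min ?_ hc h
    rintro q (rfl | rfl | rfl) <;> norm_num
  · rintro ⟨h1, h2, h3⟩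
    have hO : ((0 : ℝ), (0 : ℝ)) ∈ triangle := subset_convexHull ℝ _ (by simp)
    have hA : ((1 : ℝ), (0 : ℝ)) ∈ triangle := subset_convexHull ℝ _ (by simp)
    have hB : ((0 : ℝ), (1 : ℝ)) ∈ triangle := subset_convexHull ℝ _ (by simp)
    have hc : Convex ℝ triangle := convex_convexHull ℝ _
    rw [show p = p.1 • ((1 : ℝ), (0 : ℝ)) + p.2 • ((0 : ℝ), (1 : ℝ)) by ext <;> simp]
    have := hc.sum_mem (t := Finset.univ) (w := ![p.1, p.2, 1 - p.1 - p.2])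
      (z := ![((1 : ℝ), (0 : ℝ)), ((0 : ℝ), (1 : ℝ)), (0, 0)])
      (by intro i _; fin_cases i <;> simp <;> linarith) (by simp [Fin.sum_univ_three])
      (by intro i _; fin_cases i <;> simp <;> assumption)
    convert this using 1
    ext <;> simp [Fin.sum_univ_three]

/-- The part `{w | 0 < w.2}` of the triangle. -/
def upperTriangle : Set (ℝ × ℝ) := {w | 0 ≤ w.1 ∧ 0 < w.2 ∧ w.1 + w.2 ≤ 1}

/-- The linear part of `wedgeMap`. -/
def wedgeLin (a s : ℝ) : (ℝ × ℝ) →ₗ[ℝ] ℝ × ℝ :=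
  Matrix.toLin (Module.Basis.finTwoProd ℝ) (Module.Basis.finTwoProd ℝ) !![a, 0; -(s * a), 1 - s]

/-- The affine map with `(1,0) ↦ (a, s(1-a))`, `(0,0) ↦ (0,s)` and `(0,1) ↦ (0,1)`. It fixes the
vertex `(0,1)` and carries the side from `(0,0)` to `(1,0)` into the line joining `(0,s)` and
`(1,0)`. -/
def wedgeMap (a s : ℝ) : (ℝ × ℝ) →ᵃ[ℝ] ℝ × ℝ :=
  (wedgeLin a s).toAffineMap + AffineMap.const ℝ (ℝ × ℝ) ((0 : ℝ), s)

lemma wedgeLin_apply (a s : ℝ) (w : ℝ × ℝ) :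
    wedgeLin a s w = (a * w.1, (1 - s) * w.2 - s * a * w.1) := by
  rw [wedgeLin, Matrix.toLin_finTwoProd_apply]
  ext <;> simp; ring

lemma wedgeMap_eq_add (a s : ℝ) (w : ℝ × ℝ) : wedgeMap a s w = wedgeLin a s w + (0, s) := rfl

lemma wedgeMap_apply (a s : ℝ) (w : ℝ × ℝ) :
    wedgeMap a s w = (a * w.1, s + (1 - s) * w.2 - s * a * w.1) := by
  rw [wedgeMap_eq_add, wedgeLin_apply]
  ext <;> simp; ring

lemma det_wedgeLin (a s : ℝ) : LinearMap.det (wedgeLin a s) = (1 - s) * a := by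
  rw [wedgeLin, LinearMap.det_toLin, Matrix.det_fin_two_of]; ring

lemma wedgeMap_injective {a s : ℝ} (ha : 0 < a) (hs : s < 1) :
    Function.Injective (wedgeMap a s) := by
  intro v w h
  rw [wedgeMap_apply, wedgeMap_apply, Prod.mk.injEq] at h
  obtain ⟨h1, h2⟩ := h
  have e1 : v.1 = w.1 := mul_left_cancel₀ ha.ne' h1
  have e2 : (1 - s) * v.2 = (1 - s) * w.2 := by rw [e1] at h2; linarith
  exact Prod.ext e1 (mul_left_cancel₀ (by linarith) e2)

/-- The chain with first vertex `X = (a, s(1-a))` after `(1,0)`, all of whose further points lie in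
the triangle cut off by the lines from `X` to `(1,0)` and to `(0,1)`: it has one vertex more than
the affine image of that part of the chain in the original triangle. -/
lemma vertexCount_insert_wedge {a s : ℝ} (ha : 0 < a) (ha1 : a < 1) (hs0 : 0 < s) (hs1 : s < 1)
    {W : Set (ℝ × ℝ)} (hWf : W.Finite) (hW : W ⊆ upperTriangle) :
    vertexCount (insert ((1 : ℝ), (0 : ℝ))
      (insert (a, s * (1 - a)) (insert (0, 1) (wedgeMap a s '' W)))) =
      vertexCount ({((1 : ℝ), (0 : ℝ)), (0, 1)} ∪ W) + 1 := by
  have himg : insert (a, s * (1 - a)) (insert (0, 1) (wedgeMap a s '' W)) =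
      wedgeMap a s '' ({((1 : ℝ), (0 : ℝ)), (0, 1)} ∪ W) := by
    rw [Set.image_union, Set.image_pair, wedgeMap_apply, wedgeMap_apply, Set.insert_union,
      Set.singleton_union]
    congr 2 <;> simp; ring
  have h1 : (0 : ℝ) < 1 - a := by linarith
  have h2 : (0 : ℝ) < 1 - s := by linarith
  -- The first coordinate is below 1 away from `(1,0)`.
  have hfst : ∀ q ∈ insert (a, s * (1 - a)) (insert (0, 1) (wedgeMap a s '' W)), q.1 < 1 := by
    rintro q (rfl | rfl | ⟨w, hw, rfl⟩)
    · exact ha1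
    · norm_num
    · obtain ⟨k1, k2, k3⟩ := hW hw
      rw [wedgeMap_apply]
      have : w.1 ≤ 1 := by linarith
      show a * w.1 < 1
      nlinarith
  have hA : ((1 : ℝ), (0 : ℝ)) ∉
      convexHull ℝ (insert (a, s * (1 - a)) (insert (0, 1) (wedgeMap a s '' W))) := by
    intro h
    have : convexHull ℝ (insert (a, s * (1 - a)) (insert (0, 1) (wedgeMap a s '' W))) ⊆
        {q | LinearMap.fst ℝ ℝ ℝ q < 1} :=
      convexHull_min hfst (convex_halfSpace_lt (LinearMap.fst ℝ ℝ ℝ).isLinear _)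
    exact lt_irrefl (1 : ℝ) (this h)
  have hB : ((0 : ℝ), (1 : ℝ)) ∈ (convexHull ℝ (insert ((1 : ℝ), (0 : ℝ))
      (insert (a, s * (1 - a)) (insert (0, 1) (wedgeMap a s '' W))))).extremePoints ℝ := by
    apply extremePoint_of_forall_lt (by simp) (LinearMap.snd ℝ ℝ ℝ)
    rintro q (rfl | rfl | rfl | ⟨w, hw, rfl⟩) hq
    · norm_num
    · show s * (1 - a) < 1
      nlinarith
    · exact absurd rfl hq
    · obtain ⟨k1, k2, k3⟩ := hW hw
      rw [wedgeMap_apply] at hq ⊢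
      show s + (1 - s) * w.2 - s * a * w.1 < 1
      rcases k1.eq_or_lt with k0 | k0
      · rw [← k0] at hq k3 ⊢
        rcases k3.eq_or_lt with k4 | k4
        · exfalso; apply hq
          have : w.2 = 1 := by linarith
          rw [this]; ext <;> simp
        · nlinarith
      · have : 0 < s * a * w.1 := by positivity
        nlinarith
  have hX : (a, s * (1 - a)) ∈ (convexHull ℝ (insert ((1 : ℝ), (0 : ℝ))
      (insert (a, s * (1 - a)) (insert (0, 1) (wedgeMap a s '' W))))).extremePoints ℝ := by
    rw [mem_extremePoints_convexHull_iff]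
    refine ⟨by simp, fun h => ?_⟩
    -- `f` vanishes on the line through `(1,0)` and `X`, and is positive at all other points.
    let f : (ℝ × ℝ) →ₗ[ℝ] ℝ := LinearMap.snd ℝ ℝ ℝ + s • LinearMap.fst ℝ ℝ ℝ
    have hf : ∀ q, f q = q.2 + s * q.1 := fun q => rfl
    have hsub : insert ((1 : ℝ), (0 : ℝ)) (insert (a, s * (1 - a))
        (insert (0, 1) (wedgeMap a s '' W))) \ {(a, s * (1 - a))} ⊆
        insert ((1 : ℝ), (0 : ℝ)) (insert (0, 1) (wedgeMap a s '' W)) := by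
      rintro q ⟨rfl | rfl | hq, hq'⟩
      · exact Set.mem_insert _ _
      · exact absurd rfl hq'
      · exact Set.mem_insert_of_mem _ hq
    have h := convexHull_mono hsub h
    rw [mem_convexHull_insert_iff (Set.insert_nonempty _ _)] at h
    obtain ⟨c, hc, l, l0, l1, hl⟩ := h
    have hcf : s < f c := by
      have : convexHull ℝ (insert (0, 1) (wedgeMap a s '' W)) ⊆ {q | s < f q} := by
        refine convexHull_min ?_ (convex_halfSpace_gt f.isLinear _)
        rintro q (rfl | ⟨w, hw, rfl⟩)
        · simp [hf, hs1]
        · obtain ⟨k1, k2, k3⟩ := hW hw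
          rw [wedgeMap_apply, Set.mem_ofPred_eq, hf]
          show s < s + (1 - s) * w.2 - s * a * w.1 + s * (a * w.1)
          have : 0 < (1 - s) * w.2 := by positivity
          linarith
      exact this hc
    have e := congrArg f hl
    rw [map_add, map_smul, map_smul, hf, hf (1, 0)] at e
    simp only [smul_eq_mul] at e
    have e2 : l * (f c - s) = 0 := by linarith
    have l0' : l = 0 := by
      rcases mul_eq_zero.1 e2 with h | h
      · exact h
      · linarith
    rw [l0'] at hl
    simp at hl
    linarith [hl.1]
  have hWr : ∀ p ∈ wedgeMap a s '' W, ∃ δ : ℝ, 0 ≤ δ ∧ ∃ r ∈ segment ℝ (a, s * (1 - a)) (0, 1),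
      (1 + δ) • r = p + δ • ((1 : ℝ), (0 : ℝ)) := by
    rintro _ ⟨w, hw, rfl⟩
    obtain ⟨k1, k2, k3⟩ := hW hw
    -- `w` has barycentric coordinates `w.1, w.2, 1 - w.1 - w.2`, and `(0,s)` is the affine
    -- combination of `X` and `(1,0)` with weights `1 / (1 - a)` and `-a / (1 - a)`.
    have hδ : 0 ≤ (1 - w.1 - w.2) * a / (1 - a) :=
      div_nonneg (mul_nonneg (by linarith) ha.le) h1.le
    refine ⟨(1 - w.1 - w.2) * a / (1 - a), hδ,
      ((w.1 + (1 - w.1 - w.2) / (1 - a)) / (1 + (1 - w.1 - w.2) * a / (1 - a))) •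
        (a, s * (1 - a)) + (w.2 / (1 + (1 - w.1 - w.2) * a / (1 - a))) • ((0 : ℝ), (1 : ℝ)),
      ⟨_, _, ?_, ?_, ?_, rfl⟩, ?_⟩
    · exact div_nonneg (add_nonneg k1 (div_nonneg (by linarith) h1.le)) (by linarith)
    · exact div_nonneg k2.le (by linarith)
    · have : (1 + (1 - w.1 - w.2) * a / (1 - a)) ≠ 0 := by linarith
      rw [← add_div, div_eq_one_iff_eq this]
      field_simp; ring
    · have : (1 + (1 - w.1 - w.2) * a / (1 - a)) ≠ 0 := by linarith
      rw [smul_add, smul_smul, smul_smul, mul_div_cancel₀ _ this, mul_div_cancel₀ _ this,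
        wedgeMap_apply]
      ext
      · simp; field_simp
      · simp; field_simp; ring
  have hfin : ((convexHull ℝ (insert (a, s * (1 - a))
      (insert (0, 1) (wedgeMap a s '' W)))).extremePoints ℝ).Finite :=
    (((hWf.image _).insert _).insert _).subset extremePoints_convexHull_subset
  rw [vertexCount, extremePoints_convexHull_insert hA hX hB hWr, Set.ncard_insert_of_notMem
    (fun h => hA (extremePoints_subset h)) hfin, ← vertexCount_image (wedgeMap a s)
    (wedgeMap_injective ha hs1), ← himg, vertexCount]

lemma vertexCount_insert_of_mem_convexHull {E : Type*} [AddCommGroup E] [Module ℝ E] {S : Set E}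
    {p : E} (hp : p ∈ convexHull ℝ S) : vertexCount (insert p S) = vertexCount S := by
  have : convexHull ℝ (insert p S) = convexHull ℝ S :=
    Set.Subset.antisymm (convexHull_min (Set.insert_subset hp (subset_convexHull ℝ S))
      (convex_convexHull ℝ S)) (convexHull_mono (Set.subset_insert _ _))
  rw [vertexCount, this, vertexCount]

/-- The points of the wedge seen from `(1,0)` above `X = (a, s(1-a))` that are not in the small
triangle at `(0,1)` lie in the triangle with vertices `(1,0)`, `X`, `(0,1)`. -/
lemma mem_convexHull_of_mem_sdiff {a s : ℝ} (ha : 0 < a) (ha1 : a < 1) {p : ℝ × ℝ}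
    (hp : p ∈ wedgeMap 1 s '' upperTriangle \ wedgeMap a s '' upperTriangle) :
    p ∈ convexHull ℝ {((1 : ℝ), (0 : ℝ)), (a, s * (1 - a)), (0, 1)} := by
  obtain ⟨⟨w, ⟨k1, k2, k3⟩, rfl⟩, hn⟩ := hp
  have h1 : (0 : ℝ) < 1 - a := by linarith
  have hw : a < w.1 + a * w.2 := by
    by_contra hle
    apply hn
    refine ⟨(w.1 / a, w.2), ⟨by positivity, k2, ?_⟩, ?_⟩
    · show w.1 / a + w.2 ≤ 1
      rw [div_add' _ _ _ ha.ne', div_le_one ha]; linarith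
    · rw [wedgeMap_apply, wedgeMap_apply]
      ext <;> simp <;> field_simp
  have := (convex_convexHull ℝ {((1 : ℝ), (0 : ℝ)), (a, s * (1 - a)), (0, 1)}).sum_mem
    (t := Finset.univ)
    (w := ![(w.1 - a * (1 - w.2)) / (1 - a), (1 - w.1 - w.2) / (1 - a), w.2])
    (z := ![((1 : ℝ), (0 : ℝ)), (a, s * (1 - a)), (0, 1)])
    (by
      intro i _
      fin_cases i
      · exact div_nonneg (by linarith) h1.le
      · exact div_nonneg (by linarith) h1.le
      · exact k2.le)
    (by simp [Fin.sum_univ_three]; field_simp; ring)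
    (by intro i _; apply subset_convexHull; fin_cases i <;> simp)
  convert this using 1
  rw [wedgeMap_apply]
  ext
  · simp [Fin.sum_univ_three]; field_simp; ring
  · simp [Fin.sum_univ_three]; field_simp; ring

/-! ### Measurability of the number of vertices -/

section Measurability

variable {E ι : Type*} [Fintype ι] [NormedAddCommGroup E] [NormedSpace ℝ E]

lemma convexHull_range_eq_image_stdSimplex (y : ι → E) :
    convexHull ℝ (Set.range y) = (fun w : ι → ℝ => ∑ j, w j • y j) '' stdSimplex ℝ ι := by
  classical
  have h : (fun w : ι → ℝ => ∑ j, w j • y j) = Fintype.linearCombination ℝ y := by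
    ext w; rw [Fintype.linearCombination_apply]
  rw [h, ← convexHull_basis_eq_stdSimplex, LinearMap.image_convexHull, ← Set.range_comp]
  congr 2
  ext i
  simp [Fintype.linearCombination_apply]

lemma isClosed_setOf_mem_convexHull (i : ι) (K : Set ι) :
    IsClosed {x : ι → E | x i ∈ convexHull ℝ (x '' K)} := by
  classical
  have hc : IsClosed {q : stdSimplex ℝ K × (ι → E) | q.2 i = ∑ j : K, q.1.1 j • q.2 j} := by
    refine isClosed_eq (by fun_prop) (continuous_finsetSum _ fun j _ => ?_)
    exact ((continuous_apply j).comp (continuous_subtype_val.comp continuous_fst)).smul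
      ((continuous_apply _).comp continuous_snd)
  convert isClosedMap_snd_of_compactSpace _ hc using 1
  ext x
  rw [Set.mem_ofPred_eq, Set.image_eq_range, convexHull_range_eq_image_stdSimplex]
  constructor
  · rintro ⟨w, hw, h⟩
    exact ⟨(⟨w, hw⟩, x), h.symm, rfl⟩
  · rintro ⟨⟨w, y⟩, h, rfl⟩
    exact ⟨w.1, w.2, h.symm⟩

/-- At least `c` vertices means that `c` of the points are pairwise distinct and extreme; this
expresses the event by finitely many measurable ones even where points coincide. -/
lemma le_vertexCount_iff (x : ι → E) (c : ℕ) :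
    c ≤ vertexCount (Set.range x) ↔ ∃ s : Finset ι, s.card = c ∧
      (∀ i ∈ s, ∀ j ∈ s, i ≠ j → x i ≠ x j) ∧
      ∀ i ∈ s, x i ∈ (convexHull ℝ (Set.range x)).extremePoints ℝ := by
  classical
  have hsub : (convexHull ℝ (Set.range x)).extremePoints ℝ ⊆ Set.range x :=
    extremePoints_convexHull_subset
  have hfin : ((convexHull ℝ (Set.range x)).extremePoints ℝ).Finite :=
    (Set.finite_range x).subset hsub
  constructor
  · intro h
    obtain ⟨t, ht, htc⟩ := Set.exists_subset_card_eq h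
    obtain ⟨u, -, hu⟩ := Set.SurjOn.exists_bijOn_subset (f := x) (s := Set.univ) (t := t)
      fun p hp => by simpa using hsub (ht hp)
    refine ⟨u.toFinset, ?_, ?_, ?_⟩
    · rw [← htc, ← hu.image_eq, hu.injOn.ncard_image, Set.ncard_eq_toFinset_card']
    · intro i hi j hj hij he
      exact hij (hu.injOn (by simpa using hi) (by simpa using hj) he)
    · intro i hi
      exact ht (hu.mapsTo (by simpa using hi))
  · rintro ⟨s, hs, hinj, hext⟩
    rw [← hs, ← Finset.card_image_of_injOn (s := s) (f := x), vertexCount,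
      ← Set.ncard_coe_finset]
    · refine Set.ncard_le_ncard ?_ hfin
      intro p hp
      simp only [Finset.coe_image, Set.mem_image, Finset.mem_coe] at hp
      obtain ⟨i, hi, rfl⟩ := hp
      exact hext i hi
    · intro i hi j hj hij
      by_contra hne
      exact hinj i hi j hj hne hij

variable [SecondCountableTopology E] [MeasurableSpace E] [BorelSpace E]

lemma measurableSet_mem_extremePoints (i : ι) :
    MeasurableSet {x : ι → E | x i ∈ (convexHull ℝ (Set.range x)).extremePoints ℝ} := by
  have h : {x : ι → E | x i ∈ (convexHull ℝ (Set.range x)).extremePoints ℝ} =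
      (⋃ K : Set ι, (⋂ j ∈ K, {x : ι → E | x j = x i}ᶜ) ∩
        {x | x i ∈ convexHull ℝ (x '' K)})ᶜ := by
    ext x
    rw [Set.mem_ofPred_eq, mem_extremePoints_convexHull_iff, Set.mem_compl_iff, Set.mem_iUnion]
    constructor
    · rintro ⟨-, h⟩ ⟨K, hK, hx⟩
      refine h (convexHull_mono ?_ hx)
      rintro _ ⟨j, hj, rfl⟩
      exact ⟨⟨j, rfl⟩, Set.mem_iInter₂.1 hK j hj⟩
    · refine fun h => ⟨⟨i, rfl⟩, fun hx => h ⟨{j | x j ≠ x i}, ?_, convexHull_mono ?_ hx⟩⟩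
      · exact Set.mem_iInter₂.2 fun j hj => hj
      · rintro _ ⟨⟨j, rfl⟩, hj⟩
        exact ⟨j, hj, rfl⟩
  rw [h]
  refine (MeasurableSet.iUnion fun K => MeasurableSet.inter ?_ ?_).compl
  · refine MeasurableSet.iInter fun j => MeasurableSet.iInter fun _ => ?_
    exact (isClosed_eq (continuous_apply j) (continuous_apply i)).measurableSet.compl
  · exact (isClosed_setOf_mem_convexHull i K).measurableSet

lemma measurable_vertexCount_range : Measurable fun x : ι → E => vertexCount (Set.range x) := by
  refine measurable_of_Ici fun c => ?_
  have h : (fun x : ι → E => vertexCount (Set.range x)) ⁻¹' Set.Ici c =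
      ⋃ s ∈ {s : Finset ι | s.card = c}, (⋂ i ∈ s, ⋂ j ∈ s, ⋂ (_ : i ≠ j), {x : ι → E | x i = x j}ᶜ)
        ∩ ⋂ i ∈ s, {x : ι → E | x i ∈ (convexHull ℝ (Set.range x)).extremePoints ℝ} := by
    ext x
    rw [Set.mem_preimage, Set.mem_Ici, le_vertexCount_iff]
    simp only [Set.mem_iUnion, Set.mem_inter_iff, Set.mem_iInter, Set.mem_compl_iff,
      Set.mem_ofPred_eq, exists_prop, ne_eq]
  rw [h]
  refine MeasurableSet.iUnion fun s => MeasurableSet.iUnion fun _ => MeasurableSet.inter ?_ ?_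
  · refine MeasurableSet.iInter fun i => MeasurableSet.iInter fun _ => MeasurableSet.iInter fun j =>
      MeasurableSet.iInter fun _ => MeasurableSet.iInter fun _ => ?_
    exact (isClosed_eq (continuous_apply i) (continuous_apply j)).measurableSet.compl
  · exact MeasurableSet.iInter fun i => MeasurableSet.iInter fun _ =>
      measurableSet_mem_extremePoints i

/-- Adjoining finitely many fixed points keeps the number of vertices measurable. -/
lemma measurable_vertexCount_union {C : Set E} (hC : C.Finite) :
    Measurable fun x : ι → E => vertexCount (C ∪ Set.range x) := by
  have := hC.fintype
  have h : ∀ x : ι → E, C ∪ Set.range x = Set.range (Sum.elim ((↑) : C → E) x) := by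
    intro x; rw [Set.Sum.elim_range, Subtype.range_coe]
  simp_rw [h]
  refine measurable_vertexCount_range.comp (measurable_pi_lambda _ ?_)
  rintro (c | i)
  · exact measurable_const
  · exact measurable_pi_apply i

end Measurability

/-! ### Product measures -/

lemma range_insertNth {α : Type*} {n : ℕ} (i : Fin (n + 1)) (p : α) (y : Fin n → α) :
    Set.range (i.insertNth p y : Fin (n + 1) → α) = insert p (Set.range y) := by
  ext q
  change (∃ j, _ = q) ↔ q = p ∨ ∃ j, y j = q
  rw [Fin.exists_iff_succAbove i]
  simp [eq_comm]

section ProductMeasure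

open scoped ENNReal

variable {Ω : Type*} [MeasurableSpace Ω]

lemma measurable_insertNth {n : ℕ} (i : Fin (n + 1)) :
    Measurable fun q : Ω × (Fin n → Ω) => (i.insertNth q.1 q.2 : Fin (n + 1) → Ω) :=
  (MeasurableEquiv.piFinSuccAbove (fun _ => Ω) i).symm.measurable

lemma lintegral_pi_succAbove (ν : Measure Ω) [SigmaFinite ν] {n : ℕ} (i : Fin (n + 1))
    {F : (Fin (n + 1) → Ω) → ℝ≥0∞} (hF : Measurable F) :
    ∫⁻ x, F x ∂Measure.pi (fun _ => ν) =
      ∫⁻ p, ∫⁻ y, F (i.insertNth p y) ∂Measure.pi (fun _ : Fin n => ν) ∂ν := by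
  have h := (measurePreserving_piFinSuccAbove (fun _ : Fin (n + 1) => ν) i).symm
  rw [← h.map_eq, lintegral_map hF h.measurable]
  exact lintegral_prod _ (hF.comp (measurable_insertNth i)).aemeasurable

/-- The binomial theorem for the product of a sum of two measures, applied to a functional of the
set of points that is blind to points drawn from the first measure. -/
lemma lintegral_pi_add (ν₁ ν₂ : Measure Ω) [IsFiniteMeasure ν₁] [IsFiniteMeasure ν₂] (n : ℕ)
    (H : Set Ω → ℝ≥0∞) (hmeas : ∀ m, Measurable fun y : Fin m → Ω => H (Set.range y))
    (hH : ∀ᵐ d ∂ν₁, ∀ S, H (insert d S) = H S) :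
    ∫⁻ y, H (Set.range y) ∂Measure.pi (fun _ : Fin n => ν₁ + ν₂) =
      ∑ ij ∈ Finset.HasAntidiagonal.antidiagonal n, (n.choose ij.1 : ℝ≥0∞) *
        (ν₁ Set.univ ^ ij.2 * ∫⁻ y, H (Set.range y) ∂Measure.pi (fun _ : Fin ij.1 => ν₂)) := by
  induction n generalizing H with
  | zero => simp
  | succ n ih =>
    have hins : ∀ p m, Measurable fun y : Fin m → Ω => H (insert p (Set.range y)) := by
      intro p m
      simp_rw [← range_insertNth 0]
      exact (hmeas (m + 1)).comp ((measurable_insertNth 0).comp measurable_prodMk_left)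
    have hint : ∀ m, Measurable fun p => ∫⁻ y, H (insert p (Set.range y))
        ∂Measure.pi (fun _ : Fin m => ν₂) := by
      intro m
      simp_rw [← range_insertNth 0]
      exact ((hmeas (m + 1)).comp (measurable_insertNth 0)).lintegral_prod_right'
    rw [Finset.sum_antidiagonal_choose_succ_mul (fun i j =>
        ν₁ Set.univ ^ j * ∫⁻ y, H (Set.range y) ∂Measure.pi (fun _ : Fin i => ν₂)),
      lintegral_pi_succAbove _ 0 (hmeas (n + 1))]
    simp_rw [range_insertNth]
    rw [lintegral_add_measure]
    congr 1
    · have h1 : ∀ᵐ p ∂ν₁, ∫⁻ y, H (insert p (Set.range y))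
          ∂Measure.pi (fun _ : Fin n => ν₁ + ν₂) =
          ∫⁻ y, H (Set.range y) ∂Measure.pi (fun _ : Fin n => ν₁ + ν₂) := by
        filter_upwards [hH] with p hp
        simp_rw [hp]
      rw [lintegral_congr_ae h1, lintegral_const, ih H hmeas hH, Finset.sum_mul]
      refine Finset.sum_congr rfl fun ij _ => ?_
      ring
    · have h2 : ∀ p, ∫⁻ y, H (insert p (Set.range y)) ∂Measure.pi (fun _ : Fin n => ν₁ + ν₂) =
          ∑ ij ∈ Finset.HasAntidiagonal.antidiagonal n, (n.choose ij.1 : ℝ≥0∞) * (ν₁ Set.univ ^ ij.2 *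
            ∫⁻ y, H (insert p (Set.range y)) ∂Measure.pi (fun _ : Fin ij.1 => ν₂)) := by
        intro p
        refine ih (fun S => H (insert p S)) (hins p) ?_
        filter_upwards [hH] with d hd S
        rw [Set.insert_comm, hd]
      simp_rw [h2]
      rw [lintegral_finsetSum _ fun ij _ => ((hint _).const_mul _).const_mul _]
      refine Finset.sum_congr rfl fun ij hij => ?_
      rw [lintegral_const_mul _ ((hint _).const_mul _), lintegral_const_mul _ (hint _),
        lintegral_pi_succAbove _ 0 (hmeas (ij.1 + 1))]
      simp_rw [range_insertNth]
      rw [← Nat.choose_symm_of_eq_add (Finset.HasAntidiagonal.mem_antidiagonal.1 hij).symm]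

lemma pi_const_smul {n : ℕ} (c : ℝ≥0∞) (hc : c ≠ ∞) (ν : Measure Ω) [IsFiniteMeasure ν] :
    Measure.pi (fun _ : Fin n => c • ν) = c ^ n • Measure.pi (fun _ : Fin n => ν) := by
  have := ν.smul_finite hc
  refine Measure.pi_eq fun s _ => ?_
  rw [Measure.smul_apply, Measure.pi_pi]
  simp [Finset.prod_mul_distrib]

lemma lintegral_pi_smul_map {Ω' : Type*} [MeasurableSpace Ω'] {n : ℕ} (c : ℝ≥0∞) (hc : c ≠ ∞)
    (ν : Measure Ω) [IsFiniteMeasure ν] {f : Ω → Ω'} (hf : Measurable f)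
    {G : (Fin n → Ω') → ℝ≥0∞} (hG : Measurable G) :
    ∫⁻ y, G y ∂Measure.pi (fun _ : Fin n => c • ν.map f) =
      c ^ n * ∫⁻ w, G (fun i => f (w i)) ∂Measure.pi (fun _ : Fin n => ν) := by
  rw [pi_const_smul c hc, lintegral_smul_measure, smul_eq_mul,
    ← Measure.pi_map_pi fun _ => hf.aemeasurable, lintegral_map hG]
  exact measurable_pi_lambda _ fun i => hf.comp (measurable_pi_apply i)

lemma lintegral_indicator_pi {n : ℕ} (ν : Measure Ω) [SigmaFinite ν] {D : Set Ω}
    (hD : MeasurableSet D) (G : (Fin n → Ω) → ℝ≥0∞) :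
    ∫⁻ y, {y : Fin n → Ω | ∀ j, y j ∈ D}.indicator G y ∂Measure.pi (fun _ => ν) =
      ∫⁻ y, G y ∂Measure.pi (fun _ => ν.restrict D) := by
  have h : {y : Fin n → Ω | ∀ j, y j ∈ D} = Set.univ.pi fun _ => D := by
    ext y; simp
  rw [h, lintegral_indicator (MeasurableSet.univ_pi fun _ => hD), Measure.restrict_pi_pi]

end ProductMeasure

/-! ### The uniform distribution on the triangle -/

section Uniform

open scoped ENNReal Nat

lemma integral_pow_mul_one_sub_pow (i j : ℕ) :
    ∫ a in (0 : ℝ)..1, a ^ i * (1 - a) ^ j = (i ! * j ! : ℝ) / ((i + j + 1)! : ℝ) := by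
  induction j generalizing i with
  | zero => simp [Nat.factorial_succ]; field_simp
  | succ j ih =>
    have hd : ∀ a ∈ Set.uIcc (0 : ℝ) 1, HasDerivAt (fun a : ℝ => a ^ (i + 1) * (1 - a) ^ (j + 1))
        ((i + 1) * (a ^ i * (1 - a) ^ (j + 1)) - (j + 1) * (a ^ (i + 1) * (1 - a) ^ j)) a := by
      intro a _
      have h1 := (hasDerivAt_pow (i + 1) a).mul (((hasDerivAt_id a).const_sub 1).pow (j + 1))
      exact h1.congr_deriv (by simp; ring)
    have h := intervalIntegral.integral_eq_sub_of_hasDerivAt hd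
      (Continuous.intervalIntegrable (by fun_prop) _ _)
    rw [intervalIntegral.integral_sub (Continuous.intervalIntegrable (by fun_prop) _ _)
      (Continuous.intervalIntegrable (by fun_prop) _ _), intervalIntegral.integral_const_mul,
      intervalIntegral.integral_const_mul, ih] at h
    simp only [one_pow, sub_self, ne_eq, Nat.add_eq_zero_iff, one_ne_zero, and_false,
      not_false_eq_true, zero_pow, mul_zero, zero_mul] at h
    have hi : (i + 1 : ℝ) ≠ 0 := by positivity
    have e : ((i + 1 + j + 1)! : ℝ) = ((i + (j + 1) + 1)! : ℝ) := by
      rw [show i + 1 + j + 1 = i + (j + 1) + 1 by ring]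
    rw [e] at h
    have hf : ((i + (j + 1) + 1)! : ℝ) ≠ 0 := by positivity
    rw [Nat.factorial_succ i, Nat.cast_mul] at h
    rw [Nat.factorial_succ j, Nat.cast_mul]
    push_cast at h ⊢
    field_simp at h ⊢
    have h2 := (mul_eq_zero.1 (h.trans (mul_zero _))).resolve_left hi
    linarith

lemma lintegral_Ioo_ofReal {c : ℝ} (hc : 0 ≤ c) {h : ℝ → ℝ} (hcont : Continuous h)
    (hpos : ∀ a ∈ Set.Ioo 0 c, 0 ≤ h a) :
    ∫⁻ a in Set.Ioo 0 c, ENNReal.ofReal (h a) = ENNReal.ofReal (∫ a in (0 : ℝ)..c, h a) := by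
  rw [intervalIntegral.integral_of_le hc, integral_Ioc_eq_integral_Ioo,
    ofReal_integral_eq_lintegral_ofReal]
  · exact (hcont.integrableOn_Icc (a := 0) (b := c)).mono_set Set.Ioo_subset_Icc_self
  · exact (ae_restrict_iff' measurableSet_Ioo).2 (Filter.Eventually.of_forall hpos)

lemma measurableSet_triangle : MeasurableSet triangle := by
  have : triangle = {p : ℝ × ℝ | 0 ≤ p.1} ∩ ({p | 0 ≤ p.2} ∩ {p | p.1 + p.2 ≤ 1}) := by
    ext p; exact mem_triangle_iff
  rw [this]
  exact (measurableSet_le measurable_const measurable_fst).inter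
    ((measurableSet_le measurable_const measurable_snd).inter
      (measurableSet_le (measurable_fst.add measurable_snd) measurable_const))

lemma lintegral_triangle {f : ℝ × ℝ → ℝ≥0∞} (hf : Measurable f) :
    ∫⁻ p in triangle, f p = ∫⁻ a in Set.Ioo (0 : ℝ) 1, ∫⁻ b in Set.Ioo 0 (1 - a), f (a, b) := by
  rw [← lintegral_indicator measurableSet_triangle, Measure.volume_eq_prod,
    lintegral_prod _ (hf.indicator measurableSet_triangle).aemeasurable,
    Measure.restrict_congr_set Ioo_ae_eq_Icc, ← lintegral_indicator measurableSet_Icc]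
  congr 1 with a
  by_cases ha : a ∈ Set.Icc (0 : ℝ) 1
  · rw [Set.indicator_of_mem ha, Measure.restrict_congr_set Ioo_ae_eq_Icc,
      ← lintegral_indicator measurableSet_Icc]
    congr 1 with b
    by_cases hb : b ∈ Set.Icc 0 (1 - a)
    · rw [Set.indicator_of_mem hb, Set.indicator_of_mem]
      exact mem_triangle_iff.2 ⟨ha.1, hb.1, by have := hb.2; simp only; linarith⟩
    · rw [Set.indicator_of_notMem hb, Set.indicator_of_notMem]
      intro h
      obtain ⟨h1, h2, h3⟩ := mem_triangle_iff.1 h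
      exact hb ⟨h2, by simp only at h3; linarith⟩
  · rw [Set.indicator_of_notMem ha]
    have : ∀ b, triangle.indicator f (a, b) = 0 := by
      intro b
      apply Set.indicator_of_notMem
      intro h
      obtain ⟨h1, h2, h3⟩ := mem_triangle_iff.1 h
      simp only at h1 h2 h3
      exact ha ⟨h1, by linarith⟩
    simp [this]

lemma volume_triangle : volume triangle = 2⁻¹ := by
  have h := lintegral_triangle (measurable_const (a := (1 : ℝ≥0∞)))
  rw [setLIntegral_one] at h
  rw [h]
  simp only [setLIntegral_one, Real.volume_Ioo, sub_zero]
  rw [lintegral_Ioo_ofReal zero_le_one (by fun_prop) (fun a ha => by linarith [ha.2])]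
  have := integral_pow_mul_one_sub_pow 0 1
  simp only [pow_zero, pow_one, one_mul] at this
  rw [this]
  norm_num
  rw [ENNReal.ofReal_div_of_pos (by norm_num)]
  simp

/-- The uniform distribution on the triangle. -/
def uniform : Measure (ℝ × ℝ) := ProbabilityTheory.cond volume triangle

instance : IsProbabilityMeasure uniform :=
  cond_isProbabilityMeasure_of_finite (by rw [volume_triangle]; simp)
    (by rw [volume_triangle]; simp)

lemma uniform_eq : uniform = (2 : ℝ≥0∞) • volume.restrict triangle := by
  rw [uniform, ProbabilityTheory.cond, volume_triangle, inv_inv]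

lemma lintegral_uniform {f : ℝ × ℝ → ℝ≥0∞} (hf : Measurable f) :
    ∫⁻ p, f p ∂uniform =
      2 * ∫⁻ a in Set.Ioo (0 : ℝ) 1, ∫⁻ b in Set.Ioo 0 (1 - a), f (a, b) := by
  rw [uniform_eq, lintegral_smul_measure, smul_eq_mul, lintegral_triangle hf]

lemma ae_uniform_interior : ∀ᵐ p ∂uniform, 0 < p.1 ∧ 0 < p.2 ∧ p.1 + p.2 < 1 := by
  have hm : MeasurableSet {p : ℝ × ℝ | 0 < p.1 ∧ 0 < p.2 ∧ p.1 + p.2 < 1} :=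
    (measurableSet_lt measurable_const measurable_fst).inter
    ((measurableSet_lt measurable_const measurable_snd).inter
      (measurableSet_lt (measurable_fst.add measurable_snd) measurable_const))
  rw [ae_iff]
  change uniform {p : ℝ × ℝ | 0 < p.1 ∧ 0 < p.2 ∧ p.1 + p.2 < 1}ᶜ = 0
  rw [← lintegral_indicator_one hm.compl, lintegral_uniform (measurable_one.indicator hm.compl)]
  have : ∫⁻ a in Set.Ioo (0 : ℝ) 1, ∫⁻ b in Set.Ioo 0 (1 - a),
      ({p : ℝ × ℝ | 0 < p.1 ∧ 0 < p.2 ∧ p.1 + p.2 < 1}ᶜ).indicator (1 : ℝ × ℝ → ℝ≥0∞) (a, b) = 0 := by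
    rw [← lintegral_zero (μ := volume.restrict (Set.Ioo (0 : ℝ) 1))]
    refine setLIntegral_congr_fun measurableSet_Ioo fun a ha => ?_
    rw [← lintegral_zero (μ := volume.restrict (Set.Ioo (0 : ℝ) (1 - a)))]
    refine setLIntegral_congr_fun measurableSet_Ioo fun b hb => ?_
    have hab : (a, b) ∈ {p : ℝ × ℝ | 0 < p.1 ∧ 0 < p.2 ∧ p.1 + p.2 < 1} :=
      ⟨ha.1, hb.1, by have := hb.2; simp only; linarith⟩
    exact Set.indicator_of_notMem (Set.notMem_compl_iff.2 hab) _
  rw [this, mul_zero]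

lemma ae_uniform_mem_upperTriangle : ∀ᵐ p ∂uniform, p ∈ upperTriangle := by
  filter_upwards [ae_uniform_interior] with p hp
  exact ⟨hp.1.le, hp.2.1, hp.2.2.le⟩

lemma measurableSet_upperTriangle : MeasurableSet upperTriangle :=
  (measurableSet_le measurable_const measurable_fst).inter
    ((measurableSet_lt measurable_const measurable_snd).inter
      (measurableSet_le (measurable_fst.add measurable_snd) measurable_const))

lemma upperTriangle_subset : upperTriangle ⊆ triangle :=
  fun _ hp => mem_triangle_iff.2 ⟨hp.1, hp.2.1.le, hp.2.2⟩

lemma measurable_wedgeMap (a s : ℝ) : Measurable (wedgeMap a s) := by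
  have : (wedgeMap a s : ℝ × ℝ → ℝ × ℝ) =
      fun w => (a * w.1, s + (1 - s) * w.2 - s * a * w.1) := by
    ext1 w; exact wedgeMap_apply a s w
  rw [this]
  fun_prop

lemma measurableSet_image_wedgeMap {a s : ℝ} (ha : 0 < a) (hs : s < 1) {S : Set (ℝ × ℝ)}
    (hS : MeasurableSet S) : MeasurableSet (wedgeMap a s '' S) :=
  hS.image_of_measurable_injOn (measurable_wedgeMap a s) (wedgeMap_injective ha hs).injOn

lemma image_wedgeMap_subset {a s : ℝ} (ha : 0 < a) (ha1 : a ≤ 1) :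
    wedgeMap a s '' upperTriangle ⊆ wedgeMap 1 s '' upperTriangle := by
  rintro _ ⟨w, ⟨h1, h2, h3⟩, rfl⟩
  refine ⟨(a * w.1, w.2), ⟨by positivity, h2, ?_⟩, ?_⟩
  · show a * w.1 + w.2 ≤ 1
    nlinarith
  · rw [wedgeMap_apply, wedgeMap_apply]
    ext <;> simp; ring

lemma image_wedgeMap_subset_triangle {a s : ℝ} (ha : 0 < a) (ha1 : a ≤ 1) (hs0 : 0 ≤ s)
    (hs : s < 1) : wedgeMap a s '' upperTriangle ⊆ triangle := by
  refine (image_wedgeMap_subset ha ha1).trans ?_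
  rintro _ ⟨w, ⟨h1, h2, h3⟩, rfl⟩
  rw [wedgeMap_apply, mem_triangle_iff]
  refine ⟨?_, ?_, ?_⟩ <;> simp only <;> nlinarith

lemma volume_image_wedgeMap (a s : ℝ) (S : Set (ℝ × ℝ)) :
    volume (wedgeMap a s '' S) = ENNReal.ofReal |(1 - s) * a| * volume S := by
  have : wedgeMap a s '' S = (fun x => x + ((0 : ℝ), s)) '' (wedgeLin a s '' S) := by
    rw [← Set.image_comp]; rfl
  rw [this, Set.image_add_right, measure_preimage_add_right,
    Measure.addHaar_image_linearMap, det_wedgeLin]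

/-- The uniform distribution restricted to an affine copy of the triangle is a scaled uniform
distribution on that copy. -/
lemma uniform_restrict_wedge {a s : ℝ} (ha : 0 < a) (ha1 : a ≤ 1) (hs0 : 0 ≤ s) (hs : s < 1) :
    uniform.restrict (wedgeMap a s '' upperTriangle) =
      ENNReal.ofReal ((1 - s) * a) • uniform.map (wedgeMap a s) := by
  ext S hS
  have hpos : 0 ≤ (1 - s) * a := by nlinarith
  have hU : uniform (wedgeMap a s ⁻¹' S) = uniform (wedgeMap a s ⁻¹' S ∩ upperTriangle) := by
    refine measure_congr ?_
    filter_upwards [ae_uniform_mem_upperTriangle] with p hp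
    exact propext ⟨fun h => ⟨h, hp⟩, fun h => h.1⟩
  have hM : MeasurableSet (wedgeMap a s ⁻¹' S ∩ upperTriangle) :=
    (measurable_wedgeMap a s hS).inter measurableSet_upperTriangle
  have hI : S ∩ wedgeMap a s '' upperTriangle =
      wedgeMap a s '' (wedgeMap a s ⁻¹' S ∩ upperTriangle) := by
    rw [Set.image_preimage_inter]
  have hsub : wedgeMap a s '' (wedgeMap a s ⁻¹' S ∩ upperTriangle) ⊆ triangle :=
    (Set.image_mono Set.inter_subset_right).trans (image_wedgeMap_subset_triangle ha ha1 hs0 hs)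
  rw [Measure.restrict_apply hS, Measure.smul_apply, Measure.map_apply (measurable_wedgeMap a s) hS,
    hU, hI, uniform_eq, Measure.smul_apply, Measure.smul_apply,
    Measure.restrict_apply (measurableSet_image_wedgeMap ha hs hM), Measure.restrict_apply hM,
    Set.inter_eq_self_of_subset_left hsub,
    Set.inter_eq_self_of_subset_left (Set.inter_subset_right.trans upperTriangle_subset),
    volume_image_wedgeMap, abs_of_nonneg hpos]
  simp only [smul_eq_mul]
  ring

lemma uniform_wedge {a s : ℝ} (ha : 0 < a) (ha1 : a ≤ 1) (hs0 : 0 ≤ s) (hs : s < 1) :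
    uniform (wedgeMap a s '' upperTriangle) = ENNReal.ofReal ((1 - s) * a) := by
  have h := congrArg (fun ν => ν Set.univ) (uniform_restrict_wedge ha ha1 hs0 hs)
  simpa [Measure.map_apply (measurable_wedgeMap a s) MeasurableSet.univ] using h

end Uniform

/-! ### The recursion for the number of vertices -/

section Recursion

open scoped ENNReal Nat

instance (n : ℕ) : IsProbabilityMeasure (pointsLaw n) :=
  inferInstanceAs (IsProbabilityMeasure (Measure.pi fun _ : Fin n => uniform))

/-- The expectation of `g (f₀(T_n))`. -/
def vertexMean (n : ℕ) (g : ℕ → ℝ≥0∞) : ℝ≥0∞ := ∫⁻ x, g (numVertices x) ∂pointsLaw n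

lemma numVertices_eq {n : ℕ} (x : Fin n → ℝ × ℝ) :
    numVertices x = vertexCount ({((1 : ℝ), (0 : ℝ)), (0, 1)} ∪ Set.range x) := rfl

lemma measurable_numVertices (n : ℕ) :
    Measurable (numVertices : (Fin n → ℝ × ℝ) → ℕ) :=
  measurable_vertexCount_union (Set.toFinite {((1 : ℝ), (0 : ℝ)), (0, 1)})

/-- Given that the first vertex after `(1,0)` is `X = (a, s(1-a))`, each further point lies above
the line through `(1,0)` and `X`. It is either cut off by the segment from `X` to `(0,1)`, which
happens with probability `(1-s)a` and makes it a point of a shorter chain, or lies in the triangle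
`(1,0)`, `X`, `(0,1)`, which happens with probability `(1-s)(1-a)` and makes it irrelevant. -/
lemma lintegral_vertexCount_wedge {a s : ℝ} (ha : 0 < a) (ha1 : a < 1) (hs0 : 0 < s) (hs : s < 1)
    (n : ℕ) (g : ℕ → ℝ≥0∞) :
    ∫⁻ y : Fin n → ℝ × ℝ, g (vertexCount
        ({((1 : ℝ), (0 : ℝ)), (0, 1)} ∪ insert (a, s * (1 - a)) (Set.range y)))
        ∂Measure.pi (fun _ => uniform.restrict (wedgeMap 1 s '' upperTriangle)) =
      ∑ ij ∈ Finset.HasAntidiagonal.antidiagonal n, (n.choose ij.1 : ℝ≥0∞) *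
        (ENNReal.ofReal ((1 - s) * (1 - a)) ^ ij.2 *
          (ENNReal.ofReal ((1 - s) * a) ^ ij.1 * vertexMean ij.1 fun m => g (m + 1))) := by
  set C : Set (ℝ × ℝ) := {((1 : ℝ), (0 : ℝ)), (a, s * (1 - a)), (0, 1)} with hC
  set D : Set (ℝ × ℝ) := wedgeMap 1 s '' upperTriangle
  set D₂ : Set (ℝ × ℝ) := wedgeMap a s '' upperTriangle
  have hCS : ∀ S : Set (ℝ × ℝ),
      {((1 : ℝ), (0 : ℝ)), (0, 1)} ∪ insert (a, s * (1 - a)) S = C ∪ S := by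
    intro S; ext q; simp [hC]; tauto
  have hD : MeasurableSet D :=
    measurableSet_image_wedgeMap one_pos hs measurableSet_upperTriangle
  have hD₂ : MeasurableSet D₂ := measurableSet_image_wedgeMap ha hs measurableSet_upperTriangle
  have hsub : D₂ ⊆ D := image_wedgeMap_subset ha ha1.le
  have hsplit : uniform.restrict D = uniform.restrict (D \ D₂) + uniform.restrict D₂ := by
    rw [← Measure.restrict_union Set.disjoint_sdiff_left hD₂, Set.sdiff_union_of_subset hsub]
  have hmeas : ∀ m, Measurable fun y : Fin m → ℝ × ℝ => g (vertexCount (C ∪ Set.range y)) :=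
    fun m => (measurable_of_countable g).comp (measurable_vertexCount_union (Set.toFinite C))
  have hν₁ : uniform (D \ D₂) = ENNReal.ofReal ((1 - s) * (1 - a)) := by
    rw [measure_sdiff hsub hD₂.nullMeasurableSet (measure_ne_top _ _),
      uniform_wedge one_pos le_rfl hs0.le hs, uniform_wedge ha ha1.le hs0.le hs,
      ← ENNReal.ofReal_sub _ (by nlinarith)]
    congr 1; ring
  simp_rw [hCS, hsplit]
  rw [lintegral_pi_add _ _ n (fun S => g (vertexCount (C ∪ S))) hmeas]
  · refine Finset.sum_congr rfl fun ij _ => ?_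
    rw [Measure.restrict_apply_univ, hν₁, uniform_restrict_wedge ha ha1.le hs0.le hs,
      lintegral_pi_smul_map _ ENNReal.ofReal_ne_top _ (measurable_wedgeMap a s) (hmeas _)]
    congr 3
    refine lintegral_congr_ae ?_
    have hae : ∀ᵐ w ∂Measure.pi fun _ : Fin ij.1 => uniform, ∀ i, w i ∈ upperTriangle :=
      ae_all_iff.2 fun i => (measurePreserving_eval (fun _ : Fin ij.1 => uniform)
        i).quasiMeasurePreserving.ae ae_uniform_mem_upperTriangle
    filter_upwards [hae] with w hw
    have h := vertexCount_insert_wedge ha ha1 hs0 hs (Set.finite_range w)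
      (Set.range_subset_iff.2 hw)
    rw [numVertices_eq, ← h, ← Set.range_comp, hC, Set.insert_union, Set.insert_union,
      Set.singleton_union]
    rfl
  · rw [ae_restrict_iff' (hD.diff hD₂)]
    refine Filter.Eventually.of_forall fun d hd S => ?_
    rw [Set.union_insert, vertexCount_insert_of_mem_convexHull]
    exact convexHull_mono Set.subset_union_left (mem_convexHull_of_mem_sdiff ha ha1 hd)

/-- The slope at which a point is seen from `(1,0)`. At `(1,0)` itself the value is `0`. -/
def slope (p : ℝ × ℝ) : ℝ := p.2 / (1 - p.1)

lemma measurable_slope : Measurable slope :=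
  measurable_snd.div (measurable_const.sub measurable_fst)

lemma mem_wedge_iff_lt_slope {s : ℝ} (hs0 : 0 < s) (hs : s < 1) {p : ℝ × ℝ} (hp : p ∈ triangle) :
    p ∈ wedgeMap 1 s '' upperTriangle ↔ s < slope p := by
  obtain ⟨h1, h2, h3⟩ := mem_triangle_iff.1 hp
  have hs' : 0 < 1 - s := by linarith
  rcases (by linarith : p.1 ≤ 1).eq_or_lt with h | h
  · have h0 : slope p = 0 := by rw [slope, h]; simp
    rw [h0]
    refine ⟨?_, fun h' => by linarith⟩
    rintro ⟨w, ⟨k1, k2, k3⟩, rfl⟩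
    rw [wedgeMap_apply] at h
    simp only at h
    linarith
  · rw [slope, lt_div_iff₀ (by linarith)]
    constructor
    · rintro ⟨w, ⟨k1, k2, k3⟩, rfl⟩
      rw [wedgeMap_apply]
      simp only
      nlinarith
    · intro hlt
      refine ⟨(p.1, (p.2 - s * (1 - p.1)) / (1 - s)), ⟨h1, div_pos (by linarith) hs', ?_⟩, ?_⟩
      · show p.1 + (p.2 - s * (1 - p.1)) / (1 - s) ≤ 1
        rw [← le_sub_iff_add_le', div_le_iff₀ hs']
        nlinarith
      · rw [wedgeMap_apply]
        ext
        · simp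
        · simp; field_simp; ring

lemma uniform_restrict_lt_slope {s : ℝ} (hs0 : 0 < s) (hs : s < 1) :
    uniform.restrict {p | s < slope p} =
      uniform.restrict (wedgeMap 1 s '' upperTriangle) := by
  refine Measure.restrict_congr_set ?_
  filter_upwards [ae_uniform_mem_upperTriangle] with p hp
  exact propext (mem_wedge_iff_lt_slope hs0 hs (upperTriangle_subset hp)).symm

lemma lintegral_uniform_wedge_weights (i j : ℕ) :
    ∫⁻ p, ENNReal.ofReal ((1 - slope p) * (1 - p.1)) ^ j *
        ENNReal.ofReal ((1 - slope p) * p.1) ^ i ∂uniform =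
      ENNReal.ofReal (2 * ((i ! * (j + 1)! : ℝ) / ((i + j + 1 + 1)! : ℝ)) / (i + j + 1)) := by
  rw [lintegral_uniform (by
    have := measurable_slope
    fun_prop)]
  have h1 : ∀ a ∈ Set.Ioo (0 : ℝ) 1, ∫⁻ b in Set.Ioo 0 (1 - a),
      ENNReal.ofReal ((1 - slope (a, b)) * (1 - a)) ^ j *
        ENNReal.ofReal ((1 - slope (a, b)) * a) ^ i =
      ENNReal.ofReal ((i + j + 1 : ℝ)⁻¹ * (a ^ i * (1 - a) ^ (j + 1))) := by
    rintro a ⟨ha0, ha1⟩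
    have ha : 0 < 1 - a := by linarith
    have h2 : ∀ b ∈ Set.Ioo 0 (1 - a), ENNReal.ofReal ((1 - slope (a, b)) * (1 - a)) ^ j *
        ENNReal.ofReal ((1 - slope (a, b)) * a) ^ i =
        ENNReal.ofReal ((1 - b / (1 - a)) ^ (i + j) * (a ^ i * (1 - a) ^ j)) := by
      rintro b ⟨hb0, hb1⟩
      have hsl : 0 ≤ 1 - slope (a, b) := by
        rw [slope, sub_nonneg, div_le_one ha]; exact hb1.le
      rw [← ENNReal.ofReal_pow (by positivity), ← ENNReal.ofReal_pow (by positivity),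
        ← ENNReal.ofReal_mul (by positivity)]
      congr 1
      rw [slope, mul_pow, mul_pow, pow_add]; ring
    rw [setLIntegral_congr_fun measurableSet_Ioo h2, lintegral_Ioo_ofReal ha.le (by fun_prop)]
    · congr 1
      rw [intervalIntegral.integral_mul_const]
      have h3 := intervalIntegral.integral_comp_div (a := (0 : ℝ)) (b := 1 - a)
        (fun t => (1 - t) ^ (i + j)) ha.ne'
      rw [h3, zero_div, div_self ha.ne']
      have h4 := integral_pow_mul_one_sub_pow 0 (i + j)
      simp only [pow_zero, one_mul, Nat.factorial_zero, Nat.cast_one, zero_add,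
        Nat.factorial_succ] at h4
      rw [h4]
      push_cast
      have : ((i + j)! : ℝ) ≠ 0 := by positivity
      rw [smul_eq_mul]
      field_simp
      ring
    · rintro b ⟨hb0, hb1⟩
      have : 0 ≤ 1 - b / (1 - a) := by rw [sub_nonneg, div_le_one ha]; exact hb1.le
      positivity
  simp only
  rw [setLIntegral_congr_fun measurableSet_Ioo h1, lintegral_Ioo_ofReal zero_le_one (by fun_prop),
    intervalIntegral.integral_const_mul, integral_pow_mul_one_sub_pow]
  · rw [← ENNReal.ofReal_ofNat 2, ← ENNReal.ofReal_mul (by norm_num)]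
    congr 1
    rw [show i + (j + 1) + 1 = i + j + 1 + 1 by ring]
    field_simp
  · rintro a ⟨ha0, ha1⟩
    have : 0 ≤ 1 - a := by linarith
    positivity

/-- The event that the point with index `i` is strictly the lowest as seen from `(1,0)`. -/
def lowest {n : ℕ} (i : Fin (n + 1)) : Set (Fin (n + 1) → ℝ × ℝ) :=
  {x | ∀ j, slope (x i) < slope (x (i.succAbove j))}

lemma measurableSet_lowest {n : ℕ} (i : Fin (n + 1)) : MeasurableSet (lowest i) := by
  have : lowest i = ⋂ j, {x | slope (x i) < slope (x (i.succAbove j))} := by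
    ext x; simp [lowest]
  rw [this]
  exact MeasurableSet.iInter fun j => measurableSet_lt (measurable_slope.comp (measurable_pi_apply _))
    (measurable_slope.comp (measurable_pi_apply _))

lemma pairwise_disjoint_lowest (n : ℕ) :
    Pairwise (Function.onFun Disjoint (lowest : Fin (n + 1) → Set (Fin (n + 1) → ℝ × ℝ))) := by
  intro i k hik
  refine Set.disjoint_left.2 fun x hi hk => ?_
  obtain ⟨j, hj⟩ := Fin.exists_succAbove_eq hik
  obtain ⟨l, hl⟩ := Fin.exists_succAbove_eq hik.symm
  have h1 := hi l
  have h2 := hk j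
  rw [hl] at h1
  rw [hj] at h2
  exact lt_asymm h1 h2

/-- The contribution of the event that a fixed one of `n + 1` points is the lowest. The weight is
the probability that, moreover, exactly `i` of the other `n = i + j` points are cut off by the
segment from that point to `(0,1)`. -/
lemma lintegral_lowest {n : ℕ} (k : Fin (n + 1)) (g : ℕ → ℝ≥0∞) :
    ∫⁻ x in lowest k, g (numVertices x) ∂pointsLaw (n + 1) =
      ∑ ij ∈ Finset.HasAntidiagonal.antidiagonal n,
        ENNReal.ofReal (2 * (ij.2 + 1) / ((n + 1) * (n + 2)) / (n + 1)) *
          vertexMean ij.1 fun m => g (m + 1) := by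
  have hm : Measurable fun x : Fin (n + 1) → ℝ × ℝ => g (numVertices x) :=
    (measurable_of_countable g).comp (measurable_numVertices _)
  rw [← lintegral_indicator (measurableSet_lowest k)]
  change ∫⁻ x, _ ∂Measure.pi (fun _ => uniform) = _
  rw [lintegral_pi_succAbove _ k (hm.indicator (measurableSet_lowest k))]
  have h1 : ∀ᵐ p ∂uniform, ∫⁻ y, (lowest k).indicator (fun x => g (numVertices x))
      (k.insertNth p y) ∂Measure.pi (fun _ : Fin n => uniform) =
      ∑ ij ∈ Finset.HasAntidiagonal.antidiagonal n,
        (ENNReal.ofReal ((1 - slope p) * (1 - p.1)) ^ ij.2 *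
          ENNReal.ofReal ((1 - slope p) * p.1) ^ ij.1) *
            ((n.choose ij.1 : ℝ≥0∞) * vertexMean ij.1 fun m => g (m + 1)) := by
    filter_upwards [ae_uniform_interior] with p ⟨h1, h2, h3⟩
    have hp1 : 0 < 1 - p.1 := by linarith
    have hs0 : 0 < slope p := div_pos h2 hp1
    have hs1 : slope p < 1 := by rw [slope, div_lt_one hp1]; linarith
    have hp : (p.1, slope p * (1 - p.1)) = p := by
      ext
      · rfl
      · simp only [slope]; field_simp
    have h4 : ∀ y : Fin n → ℝ × ℝ,
        (lowest k).indicator (fun x => g (numVertices x)) (k.insertNth p y) =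
        {y : Fin n → ℝ × ℝ | ∀ j, y j ∈ {q | slope p < slope q}}.indicator
          (fun y => g (vertexCount ({((1 : ℝ), (0 : ℝ)), (0, 1)} ∪
            insert (p.1, slope p * (1 - p.1)) (Set.range y)))) y := by
      intro y
      by_cases hy : ∀ j, slope p < slope (y j)
      · rw [Set.indicator_of_mem, Set.indicator_of_mem, numVertices_eq, range_insertNth, hp]
        · exact hy
        · intro j; simpa using hy j
      · rw [Set.indicator_of_notMem, Set.indicator_of_notMem]
        · exact hy
        · intro h; exact hy fun j => by simpa using h j
    simp_rw [h4]
    rw [lintegral_indicator_pi _ (measurableSet_lt measurable_const measurable_slope),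
      uniform_restrict_lt_slope hs0 hs1, lintegral_vertexCount_wedge h1 (by linarith) hs0 hs1]
    refine Finset.sum_congr rfl fun ij _ => ?_
    ring
  rw [lintegral_congr_ae h1]
  have hmw : ∀ i j : ℕ, Measurable fun p : ℝ × ℝ =>
      ENNReal.ofReal ((1 - slope p) * (1 - p.1)) ^ j *
        ENNReal.ofReal ((1 - slope p) * p.1) ^ i := by
    intro i j
    have := measurable_slope
    fun_prop
  rw [lintegral_finsetSum _ fun ij _ => (hmw _ _).mul_const _]
  refine Finset.sum_congr rfl fun ij hij => ?_
  rw [lintegral_mul_const _ (hmw _ _), lintegral_uniform_wedge_weights, ← mul_assoc]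
  congr 1
  obtain ⟨i, j⟩ := ij
  have hn : i + j = n := Finset.HasAntidiagonal.mem_antidiagonal.1 hij
  subst hn
  simp only
  rw [← ENNReal.ofReal_natCast, ← ENNReal.ofReal_mul (by positivity)]
  congr 1
  have h6 : ((i + j).choose i : ℝ) * i ! * j ! = (i + j)! := by
    rw [Nat.choose_symm_add]
    exact_mod_cast Nat.add_choose_mul_factorial_mul_factorial i j
  rw [Nat.factorial_succ (i + j + 1), Nat.factorial_succ (i + j), Nat.factorial_succ j]
  push_cast
  rw [← h6]
  have : ((i + j).choose i : ℝ) ≠ 0 := by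
    exact_mod_cast (Nat.choose_pos (Nat.le_add_right i j)).ne'
  field_simp
  ring

lemma lintegral_iUnion_lowest (n : ℕ) (g : ℕ → ℝ≥0∞) :
    ∫⁻ x in ⋃ k : Fin (n + 1), lowest k, g (numVertices x) ∂pointsLaw (n + 1) =
      ∑ ij ∈ Finset.HasAntidiagonal.antidiagonal n,
        ENNReal.ofReal (2 * (ij.2 + 1) / ((n + 1) * (n + 2))) *
          vertexMean ij.1 fun m => g (m + 1) := by
  rw [lintegral_iUnion measurableSet_lowest (pairwise_disjoint_lowest n), tsum_fintype]
  simp_rw [lintegral_lowest]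
  rw [Finset.sum_const, Finset.card_univ, Fintype.card_fin, Finset.smul_sum]
  refine Finset.sum_congr rfl fun ij _ => ?_
  rw [nsmul_eq_mul, ← mul_assoc, ← ENNReal.ofReal_natCast, ← ENNReal.ofReal_mul (by positivity)]
  congr 2
  push_cast
  field_simp

lemma sum_antidiagonal_weights (n : ℕ) :
    ∑ ij ∈ Finset.HasAntidiagonal.antidiagonal n, (2 * ((ij.2 : ℕ) + 1 : ℝ) / ((n + 1) * (n + 2)))
      = 1 := by
  rw [← Finset.sum_div, div_eq_one_iff_eq (by positivity), ← Finset.mul_sum]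
  have h : ∑ ij ∈ Finset.HasAntidiagonal.antidiagonal n, ((ij.2 : ℕ) + 1 : ℝ) =
      ∑ k ∈ Finset.range (n + 1), ((k : ℝ) + 1) := by
    rw [← Finset.Nat.sum_antidiagonal_swap,
      Finset.Nat.sum_antidiagonal_eq_sum_range_succ_mk]
    rfl
  rw [h]
  clear h
  induction n with
  | zero => norm_num
  | succ n ih =>
    rw [Finset.sum_range_succ, mul_add, ih]
    push_cast; ring

/-- The recursion for the law of the number of vertices. That almost surely some point is strictly
lowest needs no separate proof: the weights add up to `1`. -/
lemma vertexMean_succ (n : ℕ) (g : ℕ → ℝ≥0∞) :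
    vertexMean (n + 1) g = ∑ ij ∈ Finset.HasAntidiagonal.antidiagonal n,
      ENNReal.ofReal (2 * (ij.2 + 1) / ((n + 1) * (n + 2))) *
        vertexMean ij.1 fun m => g (m + 1) := by
  rw [← lintegral_iUnion_lowest, vertexMean]
  have h : pointsLaw (n + 1) (⋃ k : Fin (n + 1), lowest k) = 1 := by
    have h1 := lintegral_iUnion_lowest n fun _ => 1
    rw [setLIntegral_one] at h1
    rw [h1]
    simp only [vertexMean, lintegral_one, measure_univ, mul_one]
    rw [← ENNReal.ofReal_sum_of_nonneg fun ij _ => by positivity, sum_antidiagonal_weights,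
      ENNReal.ofReal_one]
  have hae : (⋃ k : Fin (n + 1), lowest k) =ᵐ[pointsLaw (n + 1)] Set.univ :=
    ae_eq_univ.2 ((prob_compl_eq_zero_iff (MeasurableSet.iUnion measurableSet_lowest)).2 h)
  rw [Measure.restrict_congr_set hae, Measure.restrict_univ]

lemma numVertices_zero (x : Fin 0 → ℝ × ℝ) : numVertices x = 2 := by
  have hA : ((1 : ℝ), (0 : ℝ)) ∈
      (convexHull ℝ {((1 : ℝ), (0 : ℝ)), (0, 1)}).extremePoints ℝ := by
    apply extremePoint_of_forall_lt (by simp) (LinearMap.fst ℝ ℝ ℝ)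
    rintro q (rfl | rfl) hq
    · exact absurd rfl hq
    · simp
  have hB : ((0 : ℝ), (1 : ℝ)) ∈
      (convexHull ℝ {((1 : ℝ), (0 : ℝ)), (0, 1)}).extremePoints ℝ := by
    apply extremePoint_of_forall_lt (by simp) (LinearMap.snd ℝ ℝ ℝ)
    rintro q (rfl | rfl) hq
    · simp
    · exact absurd rfl hq
  have : (convexHull ℝ {((1 : ℝ), (0 : ℝ)), (0, 1)}).extremePoints ℝ =
      {((1 : ℝ), (0 : ℝ)), (0, 1)} :=
    Set.Subset.antisymm extremePoints_convexHull_subset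
      (Set.insert_subset hA (Set.singleton_subset_iff.2 hB))
  rw [numVertices_eq, Set.range_eq_empty, Set.union_empty, vertexCount, this,
    Set.ncard_pair (by simp)]

lemma vertexMean_zero (g : ℕ → ℝ≥0∞) : vertexMean 0 g = g 2 := by
  simp [vertexMean, numVertices_zero]

lemma vertexProb_eq (n k : ℕ) :
    vertexProb n k = (vertexMean n (({k + 2} : Set ℕ).indicator 1)).toReal := by
  have hm : MeasurableSet {x : Fin n → ℝ × ℝ | numVertices x = k + 2} :=
    measurable_numVertices n (measurableSet_singleton (k + 2))
  rw [vertexProb, Measure.real, ← lintegral_indicator_one hm]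
  rfl

lemma vertexProb_zero (k : ℕ) : vertexProb 0 k = if k = 0 then 1 else 0 := by
  rw [vertexProb_eq, vertexMean_zero]
  simp only [Set.indicator_apply, Set.mem_singleton_iff, Pi.one_apply, eq_comm (a := 2),
    Nat.add_eq_right]
  split_ifs <;> simp

lemma vertexMean_indicator_ne_top (n : ℕ) (s : Set ℕ) : vertexMean n (s.indicator 1) ≠ ∞ := by
  refine ne_top_of_le_ne_top ENNReal.one_ne_top ?_
  calc vertexMean n (s.indicator 1) ≤ ∫⁻ _, 1 ∂pointsLaw n :=
        lintegral_mono fun x => Set.indicator_le_self s 1 _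
    _ = 1 := by simp

lemma vertexProb_succ_succ (n k : ℕ) :
    vertexProb (n + 1) (k + 1) = ∑ ij ∈ Finset.HasAntidiagonal.antidiagonal n,
      2 * ((ij.2 : ℕ) + 1 : ℝ) / ((n + 1) * (n + 2)) * vertexProb ij.1 k := by
  rw [vertexProb_eq, vertexMean_succ]
  have h : (fun m => ({k + 1 + 2} : Set ℕ).indicator (1 : ℕ → ℝ≥0∞) (m + 1)) =
      ({k + 2} : Set ℕ).indicator 1 := by
    ext m
    simp only [Set.indicator_apply, Set.mem_singleton_iff, show m + 1 = k + 1 + 2 ↔ m = k + 2 by omega,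
      Pi.one_apply]
  rw [h, ENNReal.toReal_sum fun ij _ => ENNReal.mul_ne_top ENNReal.ofReal_ne_top
    (vertexMean_indicator_ne_top _ _)]
  refine Finset.sum_congr rfl fun ij _ => ?_
  rw [ENNReal.toReal_mul, ENNReal.toReal_ofReal (by positivity), vertexProb_eq]

/-- The two end points are always vertices, so a chain has at least two of them. -/
lemma vertexMean_eq_zero (n : ℕ) (g : ℕ → ℝ≥0∞) (hg : ∀ m, 2 ≤ m → g m = 0) :
    vertexMean n g = 0 := by
  induction n using Nat.strong_induction_on generalizing g with
  | _ n ih =>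
    rcases n with _ | n
    · rw [vertexMean_zero, hg 2 le_rfl]
    · rw [vertexMean_succ]
      refine Finset.sum_eq_zero fun ij hij => ?_
      rw [ih ij.1 (Nat.lt_succ_of_le (Finset.HasAntidiagonal.antidiagonal.fst_le hij)) _
        fun m hm => hg _ (by omega), mul_zero]

lemma vertexProb_succ_zero (n : ℕ) : vertexProb (n + 1) 0 = 0 := by
  rw [vertexProb_eq, vertexMean_succ]
  rw [Finset.sum_eq_zero, ENNReal.toReal_zero]
  intro ij _
  rw [vertexMean_eq_zero _ _, mul_zero]
  intro m hm
  apply Set.indicator_of_notMem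
  intro h
  have h : m + 1 = 0 + 2 := h
  omega

lemma vertexProb_eq_zero {n k : ℕ} (h : n < k) : vertexProb n k = 0 := by
  induction n using Nat.strong_induction_on generalizing k with
  | _ n ih =>
    obtain ⟨k, rfl⟩ : ∃ l, k = l + 1 := ⟨k - 1, by omega⟩
    rcases n with _ | n
    · rw [vertexProb_zero, if_neg (by omega)]
    · rw [vertexProb_succ_succ]
      refine Finset.sum_eq_zero fun ij hij => ?_
      have := Finset.HasAntidiagonal.antidiagonal.fst_le hij
      rw [ih ij.1 (by omega) (by omega), mul_zero]

lemma coeff_genPoly (n k : ℕ) : (genPoly n).coeff k = (vertexProb n k : ℂ) := by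
  rcases n with _ | _ | n
  · rw [genPoly, vertexProb_zero, Polynomial.coeff_one]
    split_ifs <;> simp
  · rw [genPoly, Polynomial.coeff_X]
    rcases k with _ | k
    · rw [vertexProb_succ_zero]; simp
    · rw [vertexProb_succ_succ]
      simp only [Finset.HasAntidiagonal.antidiagonal_zero, Finset.sum_singleton, vertexProb_zero]
      by_cases hk : k = 0
      · subst hk; norm_num
      · rw [if_neg (by omega), if_neg hk]; simp
  · rw [genPoly, Polynomial.finsetSum_coeff]
    simp only [Polynomial.coeff_C_mul, Polynomial.coeff_X_pow, mul_ite, mul_one, mul_zero]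
    rw [Finset.sum_ite_eq]
    split_ifs with h
    · rfl
    · rw [Finset.mem_Icc, not_and_or] at h
      rcases h with h | h
      · obtain rfl : k = 0 := by omega
        rw [vertexProb_succ_zero]; simp
      · rw [vertexProb_eq_zero (by omega)]; simp

/-- The recursion for the generating polynomials. -/
lemma genPoly_succ (n : ℕ) :
    genPoly (n + 1) = Polynomial.X * ∑ ij ∈ Finset.HasAntidiagonal.antidiagonal n,
      Polynomial.C (2 * ((ij.2 : ℕ) + 1 : ℂ) / ((n + 1) * (n + 2))) * genPoly ij.1 := by
  ext k
  rw [coeff_genPoly]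
  rcases k with _ | k
  · rw [vertexProb_succ_zero, Polynomial.coeff_X_mul_zero]; simp
  · rw [Polynomial.coeff_X_mul, vertexProb_succ_succ, Polynomial.finsetSum_coeff]
    push_cast
    refine Finset.sum_congr rfl fun ij _ => ?_
    rw [Polynomial.coeff_C_mul, coeff_genPoly]

end Recursion

/-! ### The equation for formal power series -/

section Formal

lemma coeff_uVar_mul (H : Series) (m : Fin 2 →₀ ℕ) :
    MvPowerSeries.coeff m (uVar * H) =
      if m 0 = 0 then 0 else MvPowerSeries.coeff (m - Finsupp.single 0 1) H := by
  classical
  rw [uVar, MvPowerSeries.X, MvPowerSeries.coeff_monomial_mul, one_mul]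
  simp only [Finsupp.single_le_iff, Nat.one_le_iff_ne_zero, ite_not]

lemma coeff_zVar_mul (H : Series) (m : Fin 2 →₀ ℕ) :
    MvPowerSeries.coeff m (zVar * H) =
      if m 1 = 0 then 0 else MvPowerSeries.coeff (m - Finsupp.single 1 1) H := by
  classical
  rw [zVar, MvPowerSeries.X, MvPowerSeries.coeff_monomial_mul, one_mul]
  simp only [Finsupp.single_le_iff, Nat.one_le_iff_ne_zero, ite_not]

lemma coeff_Xi (H : Series) (m : Fin 2 →₀ ℕ) :
    MvPowerSeries.coeff m (Xi H) = m 0 * MvPowerSeries.coeff m H := by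
  rw [Xi, coeff_uVar_mul]
  split_ifs with h
  · rw [h]; simp
  · have hm : m - Finsupp.single 0 1 + Finsupp.single 0 1 = m :=
      tsub_add_cancel_of_le (Finsupp.single_le_iff.2 (Nat.one_le_iff_ne_zero.2 h))
    rw [dU, MvPowerSeries.coeff_pderiv, hm]
    have : (((m - Finsupp.single 0 1 : Fin 2 →₀ ℕ) 0 : ℕ) : ℂ) + 1 = m 0 := by
      have h1 : (m - Finsupp.single 0 1 : Fin 2 →₀ ℕ) 0 + 1 = m 0 := by
        rw [Finsupp.tsub_apply, Finsupp.single_eq_same]; omega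
      exact_mod_cast h1
    rw [this]; ring

lemma coeff_genF (m : Fin 2 →₀ ℕ) :
    MvPowerSeries.coeff m genF = (genPoly (m 0)).coeff (m 1) := rfl

lemma genPoly_one : genPoly 1 = Polynomial.X := rfl

lemma genPoly_zero : genPoly 0 = 1 := rfl

lemma genPoly_succ_mul (n : ℕ) :
    Polynomial.C ((n + 1) * (n + 2) : ℂ) * genPoly (n + 1) =
      2 * Polynomial.X * ∑ ij ∈ Finset.HasAntidiagonal.antidiagonal n,
        Polynomial.C ((ij.2 : ℕ) + 1 : ℂ) * genPoly ij.1 := by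
  rw [genPoly_succ, Finset.mul_sum, Finset.mul_sum, Finset.mul_sum]
  refine Finset.sum_congr rfl fun ij _ => ?_
  have key : Polynomial.C ((n + 1) * (n + 2) : ℂ) *
      Polynomial.C (2 * ((ij.2 : ℕ) + 1 : ℂ) / ((n + 1) * (n + 2))) =
      2 * Polynomial.C ((ij.2 : ℕ) + 1 : ℂ) := by
    rw [← Polynomial.C_mul, show (2 : Polynomial ℂ) = Polynomial.C 2 from rfl, ← Polynomial.C_mul]
    congr 1
    have h1 : (n + 1 : ℂ) ≠ 0 := by exact_mod_cast n.succ_ne_zero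
    have h2 : (n + 2 : ℂ) ≠ 0 := by exact_mod_cast (n + 1).succ_ne_zero
    field_simp
  linear_combination Polynomial.X * genPoly ij.1 * key

/-- The second difference of the recursion for the generating polynomials, which removes its sum:
multiplication of `F` by `(1-u)²` is a second difference in `n`. -/
lemma genPoly_three_term (n : ℕ) :
    Polynomial.C ((n + 2) * (n + 3) : ℂ) * genPoly (n + 2)
      - 2 * (Polynomial.C ((n + 1) * (n + 2) : ℂ) * genPoly (n + 1))
      + Polynomial.C (n * (n + 1) : ℂ) * genPoly n = 2 * Polynomial.X * genPoly (n + 1) := by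
  let S : ℕ → Polynomial ℂ := fun n => ∑ i ∈ Finset.range (n + 1), genPoly i
  let R : ℕ → Polynomial ℂ := fun n => ∑ ij ∈ Finset.HasAntidiagonal.antidiagonal n,
    Polynomial.C ((ij.2 : ℕ) + 1 : ℂ) * genPoly ij.1
  have hR : ∀ n, R (n + 1) = R n + S (n + 1) := by
    intro n
    simp only [R, S]
    rw [Finset.Nat.antidiagonal_succ', Finset.sum_cons, Finset.sum_map, Finset.sum_range_succ _ (n + 1),
      ← Finset.Nat.sum_antidiagonal_eq_sum_range_succ (fun i _ => genPoly i) n, ← add_assoc,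
      ← Finset.sum_add_distrib]
    rw [add_comm]
    congr 1
    · refine Finset.sum_congr rfl fun ij _ => ?_
      simp
      ring
    · simp
  have hS : ∀ n, S (n + 1) = S n + genPoly (n + 1) := fun n => Finset.sum_range_succ _ _
  have h0 := genPoly_succ_mul n
  have h1 := genPoly_succ_mul (n + 1)
  change _ = 2 * Polynomial.X * R n at h0
  change _ = 2 * Polynomial.X * R (n + 1) at h1
  rw [hR, hS] at h1
  have e1 : (((n + 1 : ℕ) : ℂ) + 1) * (((n + 1 : ℕ) : ℂ) + 2) = (n + 2) * (n + 3) := by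
    push_cast; ring
  rw [e1] at h1
  rw [h1, h0]
  rcases n with _ | n
  · simp [R, S, genPoly_zero]; ring
  · have h2 := genPoly_succ_mul n
    change _ = 2 * Polynomial.X * R n at h2
    have e2 : (((n + 1 : ℕ) : ℂ)) * (((n + 1 : ℕ) : ℂ) + 1) = (n + 1) * (n + 2) := by
      push_cast; ring
    rw [e2, h2, hR, hS]
    ring

lemma thetaEquation_genF : ThetaEquation genF := by
  rw [ThetaEquation]
  have e1 : (1 - uVar) ^ 2 * (Xi (Xi genF) + Xi genF) =
      (Xi (Xi genF) + Xi genF) - uVar * (Xi (Xi genF) + Xi genF) -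
        uVar * (Xi (Xi genF) + Xi genF) + uVar * (uVar * (Xi (Xi genF) + Xi genF)) := by ring
  have e2 : 2 * uVar * zVar * genF = uVar * (zVar * genF) + uVar * (zVar * genF) := by ring
  have hD : ∀ m, MvPowerSeries.coeff m (Xi (Xi genF) + Xi genF) =
      (Polynomial.C ((m 0 : ℂ) * (m 0 + 1)) * genPoly (m 0)).coeff (m 1) := by
    intro m
    rw [map_add, coeff_Xi, coeff_Xi, coeff_genF, Polynomial.coeff_C_mul]; ring
  have hz : ∀ m, MvPowerSeries.coeff m (zVar * genF) =
      (Polynomial.X * genPoly (m 0)).coeff (m 1) := by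
    intro m
    have h01 : (Finsupp.single 1 1 : Fin 2 →₀ ℕ) 0 = 0 := Finsupp.single_eq_of_ne (by decide)
    rw [coeff_zVar_mul, coeff_genF, Finsupp.tsub_apply, Finsupp.tsub_apply, h01,
      Finsupp.single_eq_same, Nat.sub_zero]
    rcases m 1 with _ | k
    · simp
    · simp [Polynomial.coeff_X_mul]
  have h10 : (Finsupp.single 0 1 : Fin 2 →₀ ℕ) 1 = 0 := Finsupp.single_eq_of_ne (by decide)
  rw [e1, e2]
  ext m
  simp only [map_add, map_sub, coeff_uVar_mul, hz]
  simp only [← map_add, hD, Finsupp.tsub_apply, h10, Finsupp.single_eq_same, Nat.sub_zero]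
  generalize m 0 = n
  generalize m 1 = k
  rcases n with _ | _ | n
  · simp
  · simp [genPoly_one, genPoly_zero]
    rw [add_mul, one_mul, Polynomial.coeff_add]
  · have h := congrArg (fun p => p.coeff k) (genPoly_three_term n)
    simp only [Polynomial.coeff_add, Polynomial.coeff_sub, two_mul, add_mul] at h
    simp only [Nat.add_eq_zero_iff, one_ne_zero, and_false, if_false, Nat.add_sub_cancel]
    push_cast at h ⊢
    simp only [Polynomial.coeff_C_mul] at h ⊢
    linear_combination h

lemma Xi_Xi_add_Xi (H : Series) :
    Xi (Xi H) + Xi H = uVar ^ 2 * dU (dU H) + 2 * uVar * dU H := by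
  have h : dU (uVar * dU H) = dU H + uVar * dU (dU H) := by
    simp only [dU]
    rw [Derivation.leibniz, uVar, MvPowerSeries.pderiv_X_self]
    simp only [smul_eq_mul]; ring
  rw [Xi, Xi, h]; ring

lemma uVar_ne_zero : uVar ≠ 0 := by
  intro h
  have h1 := congrArg (MvPowerSeries.coeff (Finsupp.single 0 1)) h
  simp [uVar, MvPowerSeries.coeff_X] at h1

lemma uVar_ne_one : uVar ≠ 1 := by
  intro h
  have h1 := congrArg (MvPowerSeries.constantCoeff) h
  simp [uVar] at h1

lemma thetaEquation_iff_formalODE (H : Series) : ThetaEquation H ↔ FormalODE H := by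
  have hinj : Function.Injective toFrac := IsFractionRing.injective Series (FractionRing Series)
  have hu : toFrac uVar ≠ 0 := fun h => uVar_ne_zero (hinj (h.trans (map_zero _).symm))
  have hu1 : toFrac uVar - 1 ≠ 0 := fun h =>
    uVar_ne_one (hinj ((sub_eq_zero.1 h).trans (map_one _).symm))
  rw [ThetaEquation, ← hinj.eq_iff, Xi_Xi_add_Xi, FormalODE]
  simp only [toFrac, map_mul, map_add, map_pow, map_sub, map_one, map_ofNat] at hu hu1 ⊢
  field_simp
  constructor
  · intro h
    linear_combination h
  · intro h
    linear_combination h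

lemma atUZero_genF : atUZero genF = 1 := by
  ext j
  rw [atUZero, PowerSeries.coeff_mk, coeff_genF, Finsupp.single_eq_of_ne (by decide),
    Finsupp.single_eq_same, genPoly_zero, PowerSeries.coeff_one, Polynomial.coeff_one]

lemma atUZero_dU_genF : atUZero (dU genF) = PowerSeries.X := by
  ext j
  rw [atUZero, PowerSeries.coeff_mk, dU, MvPowerSeries.coeff_pderiv, coeff_genF]
  have h01 : (Finsupp.single 1 j : Fin 2 →₀ ℕ) 0 = 0 := Finsupp.single_eq_of_ne (by decide)
  have h10 : (Finsupp.single 0 1 : Fin 2 →₀ ℕ) 1 = 0 := Finsupp.single_eq_of_ne (by decide)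
  rw [Finsupp.add_apply, Finsupp.add_apply, h01, h10, Finsupp.single_eq_same,
    Finsupp.single_eq_same, zero_add, add_zero, genPoly_one, PowerSeries.coeff_X,
    Polynomial.coeff_X]
  simp [eq_comm]

end Formal

/-! ### The equation for holomorphic functions -/

section Analytic

lemma norm_genPoly_eval_le {z : ℂ} (hz : ‖z‖ ≤ 1) (n : ℕ) : ‖(genPoly n).eval z‖ ≤ 1 := by
  induction n using Nat.strong_induction_on with
  | _ n ih =>
    rcases n with _ | n
    · simp [genPoly_zero]
    · rw [genPoly_succ, Polynomial.eval_mul, Polynomial.eval_X, Polynomial.eval_finsetSum, norm_mul]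
      refine mul_le_one₀ hz (norm_nonneg _) ?_
      rw [← sum_antidiagonal_weights n]
      refine (norm_sum_le _ _).trans (Finset.sum_le_sum fun ij hij => ?_)
      rw [Polynomial.eval_mul, Polynomial.eval_C, norm_mul]
      have h1 := ih ij.1 (Nat.lt_succ_of_le (Finset.HasAntidiagonal.antidiagonal.fst_le hij))
      have h2 : ‖(2 * ((ij.2 : ℕ) + 1 : ℂ) / ((n + 1) * (n + 2)))‖ =
          2 * ((ij.2 : ℕ) + 1 : ℝ) / ((n + 1) * (n + 2)) := by
        rw [← Complex.norm_of_nonneg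
          (show (0 : ℝ) ≤ 2 * ((ij.2 : ℕ) + 1 : ℝ) / ((n + 1) * (n + 2)) by positivity)]
        push_cast; rfl
      rw [h2]
      exact mul_le_of_le_one_right (by positivity) h1

/-- Termwise differentiation of a power series in the unit disc. -/
lemma hasSum_deriv_powerSeries {c : ℕ → ℂ}
    (hc : ∀ u : ℂ, ‖u‖ < 1 → Summable fun n => c n * u ^ n) :
    DifferentiableOn ℂ (fun u => ∑' n, c n * u ^ n) (Metric.ball 0 1) ∧
    ∀ u : ℂ, ‖u‖ < 1 → HasSum (fun n : ℕ => ((n + 1) * c (n + 1)) * u ^ n)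
      (deriv (fun u => ∑' n, c n * u ^ n) u) := by
  have key : ∀ u : ℂ, ‖u‖ < 1 → DifferentiableAt ℂ (fun u => ∑' n, c n * u ^ n) u ∧
      HasSum (fun n : ℕ => ((n + 1) * c (n + 1)) * u ^ n)
        (deriv (fun u => ∑' n, c n * u ^ n) u) := by
    intro u hu
    obtain ⟨r, hur, hr1⟩ := exists_between hu
    have hr0 : 0 ≤ r := (norm_nonneg u).trans hur.le
    have hs : Summable fun n => ‖c n * (r : ℂ) ^ n‖ :=
      (hc r (by rwa [Complex.norm_of_nonneg hr0])).norm
    have hd : ∀ n : ℕ, DifferentiableOn ℂ (fun u => c n * u ^ n) (Metric.ball 0 r) :=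
      fun n => by fun_prop
    have hb : ∀ (n : ℕ) (w : ℂ), w ∈ Metric.ball 0 r → ‖c n * w ^ n‖ ≤ ‖c n * (r : ℂ) ^ n‖ := by
      intro n w hw
      rw [mem_ball_zero_iff] at hw
      rw [norm_mul, norm_mul, norm_pow, norm_pow, Complex.norm_of_nonneg hr0]
      gcongr
    have hu' : u ∈ Metric.ball (0 : ℂ) r := mem_ball_zero_iff.2 hur
    refine ⟨(Complex.differentiableOn_tsum_of_summable_norm hs hd Metric.isOpen_ball
      hb).differentiableAt (Metric.isOpen_ball.mem_nhds hu'), ?_⟩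
    have h := Complex.hasSum_deriv_of_summable_norm hs hd Metric.isOpen_ball hb hu'
    rw [← hasSum_nat_add_iff' 1] at h
    simp only [Finset.range_one, Finset.sum_singleton, pow_zero, mul_one, deriv_const, sub_zero] at h
    have e : (fun n : ℕ => ((n + 1) * c (n + 1)) * u ^ n) =
        fun n => deriv (fun u => c (n + 1) * u ^ (n + 1)) u := by
      funext n
      rw [deriv_const_mul _ (by fun_prop)]
      simp
      ring
    rwa [e]
  exact ⟨fun u hu => (key u (mem_ball_zero_iff.1 hu)).1.differentiableWithinAt,
    fun u hu => (key u hu).2⟩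

lemma evalF_properties {z : ℂ} (hz : ‖z‖ ≤ 1) :
    (∀ u : ℂ, ‖u‖ < 1 → Summable fun n : ℕ => (genPoly n).eval z * u ^ n) ∧
      DifferentiableOn ℂ (evalF z) (Metric.ball 0 1) ∧
      (∀ u : ℂ, ‖u‖ < 1 → u ≠ 0 →
        deriv (deriv (evalF z)) u + coeffP u * deriv (evalF z) u
          + coeffQ z u * evalF z u = 0) ∧
      evalF z 0 = 1 ∧ deriv (evalF z) 0 = z := by
  set c : ℕ → ℂ := fun n => (genPoly n).eval z with hc
  have hsum : ∀ u : ℂ, ‖u‖ < 1 → Summable fun n : ℕ => c n * u ^ n := by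
    intro u hu
    refine Summable.of_norm_bounded (summable_geometric_of_lt_one (norm_nonneg u) hu) fun n => ?_
    rw [norm_mul, norm_pow]
    exact mul_le_of_le_one_left (by positivity) (norm_genPoly_eval_le hz n)
  have hF : evalF z = fun u => ∑' n, c n * u ^ n := rfl
  obtain ⟨hd, h1⟩ := hasSum_deriv_powerSeries hsum
  obtain ⟨-, h2⟩ := hasSum_deriv_powerSeries fun u hu => (h1 u hu).summable
  have hrec : ∀ n : ℕ, ((n + 1) * (n + 2) : ℂ) * c (n + 1) =
      2 * z * ∑ ij ∈ Finset.HasAntidiagonal.antidiagonal n, c ij.1 * ((ij.2 : ℕ) + 1 : ℂ) := by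
    intro n
    have h := congrArg (Polynomial.eval z) (genPoly_succ_mul n)
    simp only [Polynomial.eval_mul, Polynomial.eval_C, Polynomial.eval_X, Polynomial.eval_finsetSum,
      Polynomial.eval_ofNat] at h
    rw [h]
    congr 1
    exact Finset.sum_congr rfl fun ij _ => mul_comm _ _
  have hball : ∀ u : ℂ, ‖u‖ < 1 →
      deriv (evalF z) =ᶠ[nhds u] fun u => ∑' n : ℕ, ((n + 1) * c (n + 1)) * u ^ n := by
    intro u hu
    filter_upwards [Metric.isOpen_ball.mem_nhds (mem_ball_zero_iff.2 hu)] with w hw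
    rw [hF]
    exact (h1 w (mem_ball_zero_iff.1 hw)).tsum_eq.symm
  refine ⟨hsum, hF ▸ hd, ?_, ?_, ?_⟩
  · intro u hu hu0
    have hu1 : 1 - u ≠ 0 := by
      intro h
      have : u = 1 := (sub_eq_zero.1 h).symm
      rw [this] at hu; simp at hu
    -- `u F'' + 2 F'` has the coefficients `(n+1)(n+2) c (n+1)`.
    have hA := (h2 u hu).mul_left u
    have hA' : HasSum (fun n : ℕ => (n * (n + 1) * c (n + 1)) * u ^ n)
        (u * deriv (fun u => ∑' n : ℕ, ((n + 1) * c (n + 1)) * u ^ n) u) := by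
      have e : (fun n : ℕ => (((n + 1 : ℕ) : ℂ) * ((n + 1 : ℕ) + 1) * c (n + 1 + 1)) * u ^ (n + 1)) =
          fun n : ℕ => u * (((n + 1) * ((((n + 1 : ℕ) : ℂ) + 1) * c (n + 1 + 1))) * u ^ n) := by
        funext n; push_cast; ring
      rw [← hasSum_nat_add_iff' 1, e]
      simpa using hA
    have hB := (hA'.add ((h1 u hu).mul_left 2)).tsum_eq
    have hcs : Summable fun n => ‖c n * u ^ n‖ := (hsum u hu).norm
    have hgeo : HasSum (fun n : ℕ => ((n : ℂ) + 1) * u ^ n) (1 / (1 - u) ^ 2) := by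
      have := hasSum_choose_mul_geometric_of_norm_lt_one 1 hu
      simpa using this
    have hC := tsum_mul_tsum_eq_tsum_sum_antidiagonal_of_summable_norm hcs hgeo.summable.norm
    rw [hgeo.tsum_eq] at hC
    have hD : ∀ n : ℕ, (n * (n + 1) * c (n + 1)) * u ^ n + 2 * (((n + 1) * c (n + 1)) * u ^ n) =
        2 * z * ∑ ij ∈ Finset.HasAntidiagonal.antidiagonal n,
          (c ij.1 * u ^ ij.1) * (((ij.2 : ℕ) + 1 : ℂ) * u ^ ij.2) := by
      intro n
      have e : (n * (n + 1) * c (n + 1)) * u ^ n + 2 * (((n + 1) * c (n + 1)) * u ^ n) =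
          (((n + 1) * (n + 2) : ℂ) * c (n + 1)) * u ^ n := by ring
      rw [e, hrec, mul_assoc, Finset.sum_mul]
      congr 1
      refine Finset.sum_congr rfl fun ij hij => ?_
      rw [← Finset.HasAntidiagonal.mem_antidiagonal.1 hij, pow_add]; ring
    rw [tsum_congr hD, tsum_mul_left, ← hC] at hB
    have hu1' : u - 1 ≠ 0 := fun h => hu1 (by linear_combination -h)
    rw [(hball u hu).deriv_eq, coeffP, coeffQ, hF]
    have hsq : (1 - u) ^ 2 = (u - 1) ^ 2 := by ring
    rw [hsq] at hB
    field_simp at hB ⊢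
    linear_combination -hB
  · rw [hF]
    simp only
    rw [tsum_eq_single 0 fun n hn => by simp [hn]]
    simp [hc, genPoly_zero]
  · rw [hF]
    have h := (h1 0 (by simp)).tsum_eq
    rw [← h, tsum_eq_single 0 fun n hn => by simp [hn]]
    simp [hc, genPoly_one]

end Analytic

/-! ### Regular singularities -/

section Singular

open Filter Topology

/-- Orders from a factorization; the values of the functions at the point itself are irrelevant. -/
lemma meromorphicOrderAt_eq_of_factor {f g : ℂ → ℂ} {a : ℂ} (n : ℤ) (hg : AnalyticAt ℂ g a)
    (hga : g a ≠ 0) (h : ∀ᶠ u in 𝓝[≠] a, f u = (u - a) ^ n * g u) :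
    MeromorphicAt f a ∧ meromorphicOrderAt f a = n := by
  have hm : MeromorphicAt f a := by
    have : MeromorphicAt (fun u => (u - a) ^ n * g u) a :=
      (MeromorphicAt.zpow (by fun_prop) n).mul hg.meromorphicAt
    exact this.congr (h.mono fun u hu => hu.symm)
  exact ⟨hm, (meromorphicOrderAt_eq_int_iff hm).2 ⟨g, hg, hga, h⟩⟩

lemma coeffP_zero : MeromorphicAt coeffP 0 ∧ meromorphicOrderAt coeffP 0 = (-1 : ℤ) := by
  refine meromorphicOrderAt_eq_of_factor (g := fun _ => 2) (-1) analyticAt_const two_ne_zero ?_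
  refine Eventually.of_forall fun u => ?_
  rw [coeffP, sub_zero, zpow_neg_one]; ring

lemma isRegularSingularity_zero (z : ℂ) : IsRegularSingularity coeffP (coeffQ z) 0 := by
  have hP := coeffP_zero
  have hQ : MeromorphicAt (coeffQ z) 0 ∧ (-2 : WithTop ℤ) ≤ meromorphicOrderAt (coeffQ z) 0 := by
    by_cases hz : z = 0
    · have : coeffQ z = fun _ => 0 := by ext u; simp [coeffQ, hz]
      rw [this]
      refine ⟨MeromorphicAt.const 0 0, ?_⟩
      rw [meromorphicOrderAt_eq_top_iff.2 (Eventually.of_forall fun _ => rfl)]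
      exact le_top
    · obtain ⟨h1, h2⟩ := meromorphicOrderAt_eq_of_factor (f := coeffQ z) (a := 0)
        (g := fun u => -(2 * z) / (u - 1) ^ 2) (-1)
        (by
          refine AnalyticAt.div (by fun_prop) (by fun_prop) (by norm_num))
        (by simpa using hz)
        (Eventually.of_forall fun u => by
          rw [coeffQ, sub_zero, zpow_neg_one, mul_comm u, ← div_div]; ring)
      refine ⟨h1, ?_⟩
      rw [h2]
      exact WithTop.coe_le_coe.2 (by norm_num : (-2 : ℤ) ≤ -1)
  refine ⟨hP.1, hQ.1, Or.inl ?_, ?_, hQ.2⟩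
  · rw [hP.2]; exact_mod_cast (by norm_num : (-1 : ℤ) < 0)
  · rw [hP.2]; rfl

lemma isRegularSingularity_one {z : ℂ} (hz : z ≠ 0) :
    IsRegularSingularity coeffP (coeffQ z) 1 := by
  have hP := meromorphicOrderAt_eq_of_factor (f := coeffP) (a := 1) (g := coeffP) 0
    (by
      show AnalyticAt ℂ (fun u => 2 / u) 1
      exact AnalyticAt.div (by fun_prop) (by fun_prop) one_ne_zero)
    (by simp [coeffP]) (Eventually.of_forall fun u => by simp)
  have hQ := meromorphicOrderAt_eq_of_factor (f := coeffQ z) (a := 1)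
    (g := fun u => -(2 * z) / u) (-2)
    (AnalyticAt.div (by fun_prop) (by fun_prop) one_ne_zero)
    (by simpa using hz)
    (Eventually.of_forall fun u => by
      rw [coeffQ, zpow_neg, ← div_div, div_eq_mul_inv _ ((u - 1) ^ 2)]
      norm_cast
      ring)
  refine ⟨hP.1, hQ.1, Or.inr ?_, ?_, ?_⟩
  · rw [hQ.2]; exact_mod_cast (by norm_num : (-2 : ℤ) < 0)
  · rw [hP.2]; exact WithTop.coe_le_coe.2 (by norm_num : (-1 : ℤ) ≤ 0)
  · rw [hQ.2]; rfl

/-- In the coordinate `v = 1/u` the first-order coefficient vanishes identically and the other one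
is `-2z / (v (1-v)²)`. -/
lemma isRegularSingularity_infinity {z : ℂ} (hz : z ≠ 0) :
    IsRegularSingularityAtInfinity coeffP (coeffQ z) := by
  have hP : (fun v : ℂ => 2 / v - coeffP (1 / v) / v ^ 2) = fun _ => 0 := by
    ext v
    by_cases hv : v = 0
    · simp [hv]
    · rw [coeffP]; field_simp; ring
  have hQ := meromorphicOrderAt_eq_of_factor (f := fun v => coeffQ z (1 / v) / v ^ 4) (a := 0)
    (g := fun v => -(2 * z) / (1 - v) ^ 2) (-1)
    (AnalyticAt.div (by fun_prop) (by fun_prop) (by norm_num))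
    (by simpa using hz)
    (by
      filter_upwards [self_mem_nhdsWithin,
        nhdsWithin_le_nhds (isOpen_ne.mem_nhds (zero_ne_one : (0 : ℂ) ≠ 1))] with v hv hv1
      have h0 : v ≠ 0 := hv
      have h1 : 1 - v ≠ 0 := fun h => hv1 (sub_eq_zero.1 h).symm
      have h2 : 1 / v - 1 = (1 - v) / v := by field_simp
      rw [coeffQ, sub_zero, zpow_neg_one, h2]
      field_simp)
  rw [IsRegularSingularityAtInfinity, hP]
  have htop : meromorphicOrderAt (fun _ : ℂ => (0 : ℂ)) 0 = ⊤ :=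
    meromorphicOrderAt_eq_top_iff.2 (Eventually.of_forall fun _ => rfl)
  refine ⟨MeromorphicAt.const 0 0, hQ.1, Or.inr ?_, ?_, ?_⟩
  · rw [hQ.2]; exact_mod_cast (by norm_num : (-1 : ℤ) < 0)
  · rw [htop]; exact le_top
  · rw [hQ.2]; exact WithTop.coe_le_coe.2 (by norm_num : (-2 : ℤ) ≤ -1)

end Singular

end ConvexChain

end

theorem theorem1 :
    -- the equation in terms of `Ξ`, in `ℂ[[u,z]]`
    ConvexChain.ThetaEquation ConvexChain.genF ∧
    -- it is equivalent to the equation in traditional form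
    (∀ H : ConvexChain.Series, ConvexChain.ThetaEquation H ↔ ConvexChain.FormalODE H) ∧
    -- the equation in traditional form, with the initial conditions
    ConvexChain.FormalODE ConvexChain.genF ∧
    ConvexChain.atUZero ConvexChain.genF = 1 ∧
    ConvexChain.atUZero (ConvexChain.dU ConvexChain.genF) = PowerSeries.X ∧
    -- the same for the function defined by the series for `|u| < 1` and `|z| ≤ 1`
    (∀ z : ℂ, ‖z‖ ≤ 1 →
      (∀ u : ℂ, ‖u‖ < 1 →
        Summable fun n : ℕ => (ConvexChain.genPoly n).eval z * u ^ n) ∧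
      DifferentiableOn ℂ (ConvexChain.evalF z) (Metric.ball 0 1) ∧
      (∀ u : ℂ, ‖u‖ < 1 → u ≠ 0 →
        deriv (deriv (ConvexChain.evalF z)) u
          + ConvexChain.coeffP u * deriv (ConvexChain.evalF z) u
          + ConvexChain.coeffQ z u * ConvexChain.evalF z u = 0) ∧
      ConvexChain.evalF z 0 = 1 ∧
      deriv (ConvexChain.evalF z) 0 = z) ∧
    -- the singularities
    (∀ z : ℂ, ConvexChain.IsRegularSingularity ConvexChain.coeffP (ConvexChain.coeffQ z) 0) ∧
    (∀ z : ℂ, z ≠ 0 →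
      ConvexChain.IsRegularSingularity ConvexChain.coeffP (ConvexChain.coeffQ z) 1 ∧
      ConvexChain.IsRegularSingularityAtInfinity
        ConvexChain.coeffP (ConvexChain.coeffQ z)) := by
  refine ⟨ConvexChain.thetaEquation_genF, ConvexChain.thetaEquation_iff_formalODE,
    (ConvexChain.thetaEquation_iff_formalODE _).1 ConvexChain.thetaEquation_genF,
    ConvexChain.atUZero_genF, ConvexChain.atUZero_dU_genF,
    fun z hz => ConvexChain.evalF_properties hz,
    ConvexChain.isRegularSingularity_zero,
    fun z hz => ⟨ConvexChain.isRegularSingularity_one hz,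
      ConvexChain.isRegularSingularity_infinity hz⟩⟩
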